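/- Let $k_0,b_0>0$, let $N\ge 1$ be the number of vehicles, and put $\rho_0=N/(2\pi)$, $a_0^2=k_0/\rho_0^2$. For $\varepsilon\ge 0$ and $k^{(f,purt)},k^{(b,purt)}\in L^\infty([0,2\pi])$ consider the mistuned PDE $$\frac{\partial^2 v}{\partial t^2}+b_0\frac{\partial v}{\partial t}=a_0^2\frac{\partial^2 v}{\partial x^2}+\varepsilon\Big[\frac{k_m}{\rho_0}\frac{\partial v}{\partial x}+\frac{k_s}{2\rho_0^2}\frac{\partial^2 v}{\partial x^2}\Big],\qquad k_m=k^{(f,purt)}-k^{(b,purt)},\quad k_s=k^{(f,purt)}+k^{(b,purt)},$$ on $[0,2\pi]$ with the Neumann–Dirichlet conditions $\partial_x v(0,t)=v(2\pi,t)=0$. A number $s\in\mathbb C$ is an eigenvalue if $v(x,t)=e^{st}\eta(x)$ is a solution for some $\eta\not\equiv0$ (with $\eta'$ absolutely continuous and the equation holding almost everywhere). A real eigenvalue is the least stable one if all other eigenvalues have strictly smaller real part. Take $k^{(b,purt)}=-k^{(f,purt)}$, where the profile $k=k^{(f,purt)}\in L^\infty([0,2\pi])$ is admissible, i.e. $\max_{[0,2\pi]}k=1$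 (essential maximum), and let $s_1^+(\varepsilon)=s_1^+(\varepsilon;N,k)$ be the largest real part of an eigenvalue. (i) The constant profile $k\equiv1$ is admissible, and it is the unique first-order optimal profile: let $N>\pi\sqrt{k_0}/b_0$. For every admissible $k$, for all sufficiently small $\varepsilon\ge0$ the number $s_1^+(\varepsilon;N,k)$ is the least stable eigenvalue. The right derivative $r(N,k)=\frac{d}{d\varepsilon}s_1^+(\varepsilon;N,k)\big|_{\varepsilon=0^+}$ exists, and $r(N,1)\le r(N,k)$, with equality if and only if $k=1$ almost everywhere. In particular, if $k$ is admissible and not almost everywhere equal to $1$, then $s_1^+(\varepsilon;N,1)<s_1^+(\varepsilon;N,k)$ for all sufficiently small $\varepsilon>0$. (ii) For $k\equiv1$, as $\varepsilon\to0$ and $N\to\infty$, $$s_1^+(\varepsilon;N,1)=-\frac{2\varepsilon}{b_0N}+O(\varepsilon^2)+O(1/N^2).$$ More precisely, there are constants $C$, $\varepsilon_0>0$ and $N_0\ge 1$ depending only on $k_0,b_0$ such that for all $N\ge N_0$ and $0\le\varepsilon\le\varepsilon_0$ the number $s_1^+(\varepsilon;N,1)$ is the least stable eigenvalue, and $$|s_1^+(\varepsilon;N,1)-s_1^+(0;N,1)-\varepsilon\,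 r(N,1)|\le C\varepsilon^2,\qquad |s_1^+(0;N,1)|\le \frac{C}{N^2},\qquad \Big|r(N,1)+\frac{2}{b_0N}\Big|\le\frac{C}{N^2}.$$ -/

import Mathlib

open Set Filter Topology MeasureTheory

noncomputable section

namespace Platoon

/-- Lebesgue measure on the scaled platoon domain `[0, 2π]`. -/
def domainMeasure : Measure ℝ := volume.restrict (Icc 0 (2 * Real.pi))

/-- Mean density `ρ₀ = N / (2π)` of a platoon of `N` vehicles. -/
def meanDensity (N : ℕ) : ℝ := N / (2 * Real.pi)

/-- `η` is an eigenfunction, with eigenvalue `s`, of the mistuned PDE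
`v_tt + b₀ v_t = a₀² v_xx + ε ((k_m / ρ₀) v_x + (k_s / (2 ρ₀²)) v_xx)`, where `a₀² = k₀ / ρ₀²`,
`k_s = kf + kb`, `k_m = kf - kb`, with Neumann-Dirichlet boundary conditions
`v_x(0, t) = v(2π, t) = 0`. That is, `η` is not identically zero on `[0, 2π]` and
`v(x, t) = exp (s t) η(x)` solves the problem. As the coefficients are only in `L^∞`, the equation
is understood almost everywhere: `η` is differentiable, its derivative `ψ` is absolutely continuous
(the integral of an integrable `g`), and `g` is the second derivative. -/
def IsEigenfunctionND (k₀ b₀ ε : ℝ) (N : ℕ) (kf kb : ℝ → ℝ) (s : ℂ) (η : ℝ → ℂ) : Prop :=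
  (∃ x ∈ Icc (0 : ℝ) (2 * Real.pi), η x ≠ 0) ∧
  ∃ ψ g : ℝ → ℂ,
    (∀ x ∈ Icc (0 : ℝ) (2 * Real.pi),
      HasDerivWithinAt η (ψ x) (Icc (0 : ℝ) (2 * Real.pi)) x) ∧
    IntervalIntegrable g volume 0 (2 * Real.pi) ∧
    (∀ x ∈ Icc (0 : ℝ) (2 * Real.pi), ψ x = ψ 0 + ∫ t in (0 : ℝ)..x, g t) ∧
    (∀ᵐ x ∂domainMeasure,
      s ^ 2 * η x + (b₀ : ℂ) * s * η x =
        ((k₀ / meanDensity N ^ 2 : ℝ) : ℂ) * g x +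
        (ε : ℂ) * ((((kf x - kb x) / meanDensity N : ℝ) : ℂ) * ψ x +
          (((kf x + kb x) / (2 * meanDensity N ^ 2) : ℝ) : ℂ) * g x)) ∧
    ψ 0 = 0 ∧ η (2 * Real.pi) = 0

/-- The set of (complex) eigenvalues of the mistuned PDE with Neumann-Dirichlet conditions. -/
def eigenvaluesND (k₀ b₀ ε : ℝ) (N : ℕ) (kf kb : ℝ → ℝ) : Set ℂ :=
  {s | ∃ η : ℝ → ℂ, IsEigenfunctionND k₀ b₀ ε N kf kb s η}

/-- The real number `σ` belongs to the set `S` of eigenvalues and every other member of `S` lies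
strictly to the left of it: `σ` is the least stable eigenvalue. -/
def IsLeastStable (S : Set ℂ) (σ : ℝ) : Prop :=
  (σ : ℂ) ∈ S ∧ ∀ z ∈ S, z ≠ (σ : ℂ) → z.re < σ

/-- The largest real part of an eigenvalue when the front and back gains are
`k₀ + ε k` and `k₀ - ε k`. It is the least stable eigenvalue `s₁⁺(ε)` whenever the latter exists in
the sense of `IsLeastStable`. -/
def sOnePlus (k₀ b₀ : ℝ) (N : ℕ) (k : ℝ → ℝ) (ε : ℝ) : ℝ :=
  sSup (Complex.re '' eigenvaluesND k₀ b₀ ε N k (fun x => -k x))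

/-- Admissible front profiles: `k ∈ L^∞([0, 2π])` whose (essential) maximum is `1`. -/
def IsAdmissible (k : ℝ → ℝ) : Prop :=
  MemLp k ⊤ domainMeasure ∧ essSup k domainMeasure = 1

theorem IsLeastStable.sSup_eq {S : Set ℂ} {σ : ℝ} (h : IsLeastStable S σ) :
    sSup (Complex.re '' S) = σ := by
  refine IsGreatest.csSup_eq ⟨⟨(σ : ℂ), h.1, Complex.ofReal_re σ⟩, ?_⟩
  rintro _ ⟨z, hz, rfl⟩
  by_cases hzs : z = (σ : ℂ)
  · rw [hzs, Complex.ofReal_re]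
  · exact (h.2 z hz hzs).le

end Platoon

end

/-! With opposite gain perturbations the second-order term cancels, and the mode equation becomes
η'' + c k η' = -ν η, where c = 2ερ₀/k₀ and s² + b₀s = -a₀²ν. The integrating factor p = exp(c∫k)
turns it into the Sturm–Liouville problem -(pη')' = νpη. Although k is only essentially bounded, p
is continuous, so classical pointwise arguments apply to η and pη'.

Green's identity makes every ν real, and Sturm–Picone comparison makes the principal eigenvalue μ,
which has a positive eigenfunction, the smallest. If the discriminant b₀² - 4a₀²μ is positive, the
larger root of s² + b₀s = -a₀²μ therefore lies strictly to the right of all other eigenvalues. So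
`sOnePlus` is an explicit smooth function of μ.

The dependence of μ on ε is read off the Prüfer angle in η = R cos θ, pη' = -(1/4)R sin θ,
normalised so that for p = 1 the principal eigenvalue is 1/16 and θ(x) = x/4 exactly. The principal
eigenvalue is characterised by θ(2π) = π/2. Integrating θ' over the interval for p = exp f gives μ =
1/16 - (1/(16π))∫ f cos(x/2) + O(sup|f|²) (`IsPrincipal.abs_sub_le`). Taking f = c∫k and integrating
by parts, the derivative of s₁⁺ is a positive multiple of -2∫ k sin(x/2). Since k ≤ 1 and sin(x/2) >
0 inside the interval, it is smallest exactly for k = 1 almost everywhere.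

For k = 1 the drift c = εN/(πk₀) is not small uniformly in N. An explicit comparison solution
extends the quadratic error bound to all c ≥ 0, and a₀²c² = 4ε²/k₀ does not depend on N, which gives
the uniform asymptotics. -/

/-! ### Sturm–Picone comparison -/

/-- Sturm--Picone comparison on `[0, b]`, allowing the positive solution `η₁` to vanish at `b` as
long as its quasi-derivative `y₁` does not. -/
theorem sturm_picone {b : ℝ} (hb : 0 < b) {η₁ y₁ η y p₁ P Q₁ Q : ℝ → ℝ}
    (hη₁ : ∀ x ∈ Icc 0 b, HasDerivWithinAt η₁ (y₁ x / p₁ x) (Icc 0 b) x)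
    (hy₁ : ∀ x ∈ Icc 0 b, HasDerivWithinAt y₁ (-(Q₁ x * η₁ x)) (Icc 0 b) x)
    (hη : ∀ x ∈ Icc 0 b, HasDerivWithinAt η (y x / P x) (Icc 0 b) x)
    (hy : ∀ x ∈ Icc 0 b, HasDerivWithinAt y (-(Q x * η x)) (Icc 0 b) x)
    (hpos : ∀ x ∈ Ico 0 b, 0 < η₁ x) (hend : η₁ b ≠ 0 ∨ y₁ b ≠ 0)
    (hp₁ : ∀ x ∈ Icc 0 b, 0 < p₁ x) (hpP : ∀ x ∈ Icc 0 b, p₁ x ≤ P x)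
    (hQ : ∀ x ∈ Icc 0 b, Q x < Q₁ x)
    (hy₁0 : y₁ 0 = 0) (h0 : 0 ≤ y 0 * η 0) (hηb : η b = 0) :
    ∀ x ∈ Icc 0 b, η x = 0 := by
  have hbmem : b ∈ Icc 0 b := ⟨hb.le, le_rfl⟩
  -- Picone's identity: the derivative of `W` is the sum of squares `W'` with nonnegative weights.
  -- Since `W` starts nonnegative and tends to 0 at `b`, it vanishes throughout, and the strict
  -- inequality between the potentials forces `η = 0`.
  set W : ℝ → ℝ := fun x => y x * η x - y₁ x * (η x ^ 2 / η₁ x) with hW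
  set W' : ℝ → ℝ := fun x => (Q₁ x - Q x) * η x ^ 2 + (y x - y₁ x * η x / η₁ x) ^ 2 / P x
    + (1 / p₁ x - 1 / P x) * (y₁ x * η x / η₁ x) ^ 2 with hW'
  have hWd : ∀ x ∈ Ico 0 b, HasDerivWithinAt W (W' x) (Icc 0 b) x := by
    intro x hx
    have hx' : x ∈ Icc 0 b := Ico_subset_Icc_self hx
    have h1 := hpos x hx
    have h2 := hp₁ x hx'
    have h3 := h2.trans_le (hpP x hx')
    have := ((hy x hx').mul (hη x hx')).sub
      ((hy₁ x hx').mul (((hη x hx').pow 2).div (hη₁ x hx') h1.ne'))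
    refine this.congr_deriv ?_
    simp only [hW', Pi.pow_apply, Pi.div_apply]
    field_simp
    ring
  have hW'nn : ∀ x ∈ Ico 0 b, (Q₁ x - Q x) * η x ^ 2 ≤ W' x := by
    intro x hx
    have hx' : x ∈ Icc 0 b := Ico_subset_Icc_self hx
    have h2 := hp₁ x hx'
    have h3 := hpP x hx'
    have h4 := h2.trans_le h3
    have h5 : 0 ≤ 1 / p₁ x - 1 / P x := sub_nonneg.2 (one_div_le_one_div_of_le h2 h3)
    have h6 : 0 ≤ (y x - y₁ x * η x / η₁ x) ^ 2 / P x := by positivity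
    have h7 := mul_nonneg h5 (sq_nonneg (y₁ x * η x / η₁ x))
    simp only [hW']
    linarith
  have hWmono : MonotoneOn W (Ico 0 b) := by
    refine monotoneOn_of_deriv_nonneg (convex_Ico 0 b)
      (fun x hx => ((hWd x hx).mono Ico_subset_Icc_self).continuousWithinAt) ?_ ?_
    · intro x hx
      rw [interior_Ico] at hx
      exact (((hWd x (Ioo_subset_Ico_self hx)).hasDerivAt
        (Icc_mem_nhds hx.1 hx.2)).differentiableAt).differentiableWithinAt
    · intro x hx
      rw [interior_Ico] at hx
      have hx' := Ioo_subset_Ico_self hx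
      rw [((hWd x hx').hasDerivAt (Icc_mem_nhds hx.1 hx.2)).deriv]
      exact (mul_nonneg (sub_nonneg.2 (hQ x (Ico_subset_Icc_self hx')).le)
        (sq_nonneg _)).trans (hW'nn x hx')
  have hsub : 𝓝[Ico 0 b] b ≤ 𝓝[Icc 0 b] b := nhdsWithin_mono _ Ico_subset_Icc_self
  have hηt : Tendsto η (𝓝[Ico 0 b] b) (𝓝 0) := by
    have := (hη b hbmem).continuousWithinAt.tendsto.mono_left hsub
    rwa [hηb] at this
  have hyt : Tendsto y (𝓝[Ico 0 b] b) (𝓝 (y b)) :=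
    (hy b hbmem).continuousWithinAt.tendsto.mono_left hsub
  have hy₁t : Tendsto y₁ (𝓝[Ico 0 b] b) (𝓝 (y₁ b)) :=
    (hy₁ b hbmem).continuousWithinAt.tendsto.mono_left hsub
  have hη₁t : Tendsto η₁ (𝓝[Ico 0 b] b) (𝓝 (η₁ b)) :=
    (hη₁ b hbmem).continuousWithinAt.tendsto.mono_left hsub
  -- If `η₁` vanishes at `b`, it does so only to first order because `y₁ b ≠ 0`, while `η ^ 2`
  -- vanishes to second order. The quotient is rewritten through slopes at `b`.
  have hquot : Tendsto (fun x => η x ^ 2 / η₁ x) (𝓝[Ico 0 b] b) (𝓝 0) := by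
    by_cases hz : η₁ b = 0
    · have hyb : y₁ b ≠ 0 := hend.resolve_left (not_not.2 hz)
      have hslope : ∀ {f : ℝ → ℝ} {f' : ℝ}, HasDerivWithinAt f f' (Icc 0 b) b →
          Tendsto (slope f b) (𝓝[Ico 0 b] b) (𝓝 f') := by
        intro f f' hf
        have := hasDerivWithinAt_iff_tendsto_slope.1 hf
        rwa [Icc_sdiff_right] at this
      have s1 := hslope (hη b hbmem)
      have s2 := hslope (hη₁ b hbmem)
      have s3 : Tendsto (fun x => x - b) (𝓝[Ico 0 b] b) (𝓝 0) := by
        have : Tendsto (fun x => x - b) (𝓝 b) (𝓝 (b - b)) :=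
          (continuous_id.sub continuous_const).tendsto b
        rw [sub_self] at this
        exact this.mono_left nhdsWithin_le_nhds
      have s4 := ((s1.pow 2).mul s3).div s2 (div_ne_zero hyb (hp₁ b hbmem).ne')
      rw [mul_zero, zero_div] at s4
      refine s4.congr' ?_
      filter_upwards [self_mem_nhdsWithin] with x hx
      have hxb : x - b ≠ 0 := sub_ne_zero.2 hx.2.ne
      have := (hpos x hx).ne'
      simp only [Pi.div_apply, slope_def_field, hηb, hz, sub_zero]
      field_simp
    · have := (hηt.pow 2).div hη₁t hz
      rwa [zero_pow two_ne_zero, zero_div] at this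
  have hWt : Tendsto W (𝓝[Ico 0 b] b) (𝓝 0) := by
    have := (hyt.mul hηt).sub (hy₁t.mul hquot)
    simpa using this
  have hne : (𝓝[Ico 0 b] b).NeBot := by
    rw [nhdsWithin_Ico_eq_nhdsLT hb]; infer_instance
  have hW0 : 0 ≤ W 0 := by simp only [hW, hy₁0, zero_mul, sub_zero]; exact h0
  have hWle : ∀ x ∈ Ico 0 b, W x ≤ 0 := by
    intro x hx
    refine ge_of_tendsto hWt ?_
    have : Ioi x ∈ 𝓝[Ico 0 b] b := mem_nhdsWithin_of_mem_nhds (Ioi_mem_nhds hx.2)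
    filter_upwards [this, self_mem_nhdsWithin] with z hz hz'
    exact hWmono hx hz' (le_of_lt hz)
  have hWz : ∀ x ∈ Ico 0 b, W x = 0 := fun x hx =>
    le_antisymm (hWle x hx) (hW0.trans (hWmono ⟨le_rfl, hb⟩ hx hx.1))
  have hηz : ∀ x ∈ Ioo 0 b, η x = 0 := by
    intro x hx
    have hx' := Ioo_subset_Ico_self hx
    have h1 := (hWd x hx').hasDerivAt (Icc_mem_nhds hx.1 hx.2)
    have h2 : HasDerivAt W 0 x := by
      refine (hasDerivAt_const x (0 : ℝ)).congr_of_eventuallyEq ?_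
      filter_upwards [Ioo_mem_nhds hx.1 hx.2] with z hz
      exact hWz z (Ioo_subset_Ico_self hz)
    have h3 := hW'nn x hx'
    rw [h1.unique h2] at h3
    have h4 := sub_pos.2 (hQ x (Ico_subset_Icc_self hx'))
    have h5 : η x ^ 2 ≤ 0 := by
      by_contra hcon
      have := mul_pos h4 (not_le.1 hcon)
      linarith
    exact pow_eq_zero_iff two_ne_zero |>.1 (le_antisymm h5 (sq_nonneg _))
  have hcl : EqOn η (fun _ => 0) (Icc 0 b) := by
    refine EqOn.of_subset_closure (s := Ioo 0 b) hηz
      (fun x hx => (hη x hx).continuousWithinAt) continuousOn_const Ioo_subset_Icc_self ?_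
    rw [closure_Ioo hb.ne]
  exact hcl

/-! ### Sturm–Liouville problem and Prüfer angle -/

namespace Platoon

/-- The scaled platoon domain `[0, 2π]`. -/
abbrev dom : Set ℝ := Icc 0 (2 * Real.pi)

/-- `η` is an eigenfunction of `-(p η')' = μ p η`, `η'(0) = η(2π) = 0`, with quasi-derivative
`y = p η'`. -/
structure IsSturmEigenfunction {𝕜 : Type*} [RCLike 𝕜] (p : ℝ → ℝ) (μ : 𝕜) (η y : ℝ → 𝕜) :
    Prop where
  hasDeriv : ∀ x ∈ dom, HasDerivWithinAt η ((p x)⁻¹ • y x) dom x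
  hasDeriv_quasi : ∀ x ∈ dom, HasDerivWithinAt y (-(μ * (p x • η x))) dom x
  quasi_zero : y 0 = 0
  end_zero : η (2 * Real.pi) = 0
  ne_zero : ∃ x ∈ dom, η x ≠ 0

/-- Right-hand side of the equation of the Prüfer angle `θ` in `η = R cos θ`,
`p η' = -(1/4) R sin θ`. -/
noncomputable def pruferField (p : ℝ → ℝ) (μ x θ : ℝ) : ℝ :=
  Real.sin θ ^ 2 / (4 * p x) + 4 * μ * p x * Real.cos θ ^ 2

/-- `θ` is the Prüfer angle of the solution with Neumann condition at `0`. -/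
structure IsPruferAngle (p : ℝ → ℝ) (μ : ℝ) (θ : ℝ → ℝ) : Prop where
  hasDeriv : ∀ x ∈ dom, HasDerivWithinAt θ (pruferField p μ x (θ x)) dom x
  zero : θ 0 = 0

/-- `μ` is the principal eigenvalue of `-(p η')' = μ p η`, `η'(0) = η(2π) = 0`. -/
def IsPrincipal (p : ℝ → ℝ) (μ : ℝ) : Prop :=
  0 < μ ∧ ∃ θ, IsPruferAngle p μ θ ∧ θ (2 * Real.pi) = Real.pi / 2

theorem zero_mem_dom : (0 : ℝ) ∈ dom := ⟨le_rfl, Real.two_pi_pos.le⟩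

theorem two_pi_mem_dom : 2 * Real.pi ∈ dom := ⟨Real.two_pi_pos.le, le_rfl⟩

theorem hasDerivWithinAt_integral {E : Type*} [NormedAddCommGroup E] [NormedSpace ℝ E]
    [CompleteSpace E] {f : ℝ → E} (hf : ContinuousOn f dom) :
    ∀ x ∈ dom, HasDerivWithinAt (fun x => ∫ t in (0 : ℝ)..x, f t) (f x) dom x := by
  intro x hx
  have hc : Continuous (IccExtend Real.two_pi_pos.le (dom.domRestrict f)) :=
    (continuousOn_iff_continuous_domRestrict.1 hf).Icc_extend'
  have hd := (hc.integral_hasStrictDerivAt 0 x).hasDerivAt.hasDerivWithinAt (s := dom)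
  rw [IccExtend_of_mem _ _ hx] at hd
  have heq : ∀ z ∈ dom, (∫ t in (0 : ℝ)..z, f t) =
      ∫ t in (0 : ℝ)..z, IccExtend Real.two_pi_pos.le (dom.domRestrict f) t := by
    intro z hz
    refine intervalIntegral.integral_congr fun t ht => ?_
    rw [uIcc_of_le hz.1] at ht
    have ht' : t ∈ dom := ⟨ht.1, ht.2.trans hz.2⟩
    simp only [IccExtend_of_mem _ _ ht']
    rfl
  exact hd.congr heq (heq x hx)

theorem exists_primitive {f : ℝ → ℝ} (hf : ContinuousOn f dom) :
    ∃ F : ℝ → ℝ, F 0 = 0 ∧ ∀ x ∈ dom, HasDerivWithinAt F (f x) dom x :=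
  ⟨fun x => ∫ t in (0 : ℝ)..x, f t, by simp, hasDerivWithinAt_integral hf⟩

theorem sin_sq_lipschitz (a b : ℝ) : |Real.sin a ^ 2 - Real.sin b ^ 2| ≤ |a - b| := by
  have h : Real.sin a ^ 2 - Real.sin b ^ 2 = Real.sin (a + b) * Real.sin (a - b) := by
    rw [Real.sin_add, Real.sin_sub]
    linear_combination (-Real.sin a ^ 2) * Real.sin_sq_add_cos_sq b
      + (Real.sin b ^ 2) * Real.sin_sq_add_cos_sq a
  rw [h, abs_mul]
  have h1 := Real.abs_sin_le_one (a + b)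
  have h2 : |Real.sin (a - b)| ≤ |a - b| := Real.abs_sin_le_abs
  nlinarith [abs_nonneg (Real.sin (a - b)), abs_nonneg (a - b)]

theorem cos_sq_lipschitz (a b : ℝ) : |Real.cos a ^ 2 - Real.cos b ^ 2| ≤ |a - b| := by
  rw [Real.cos_sq', Real.cos_sq', sub_sub_sub_cancel_left, abs_sub_comm a b]
  exact sin_sq_lipschitz b a

theorem pruferField_dist_le {p : ℝ → ℝ} {m M x : ℝ} (hm : 0 < m) (hp : p x ∈ Icc m M)
    {B μ : ℝ} (hμ : |μ| ≤ B) (a b : ℝ) :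
    |pruferField p μ x a - pruferField p μ x b| ≤ (1 / (4 * m) + 4 * B * M) * |a - b| := by
  have hp0 : 0 < p x := hm.trans_le hp.1
  have h : pruferField p μ x a - pruferField p μ x b =
      (1 / (4 * p x)) * (Real.sin a ^ 2 - Real.sin b ^ 2)
        + 4 * μ * p x * (Real.cos a ^ 2 - Real.cos b ^ 2) := by
    unfold pruferField; ring
  rw [h, add_mul]
  have hB : 0 ≤ B := (abs_nonneg μ).trans hμ
  refine (abs_add_le _ _).trans (add_le_add ?_ ?_)
  · rw [abs_mul, abs_of_pos (by positivity : 0 < 1 / (4 * p x))]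
    exact mul_le_mul (one_div_le_one_div_of_le (by linarith) (by linarith [hp.1]))
      (sin_sq_lipschitz a b) (abs_nonneg _) (by positivity)
  · rw [abs_mul, abs_mul, abs_mul, abs_of_pos hp0, abs_of_pos (by norm_num : (0 : ℝ) < 4)]
    have : 0 < M := hp0.trans_le hp.2
    have h1 : 4 * |μ| * p x ≤ 4 * B * M :=
      mul_le_mul (by linarith) hp.2 hp0.le (by positivity)
    exact mul_le_mul h1 (cos_sq_lipschitz a b) (abs_nonneg _) (by positivity)

/-- The field is bounded and Lipschitz in the angle with the same constant `L`, globally in the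
angle. A ball of radius `L` times 2π thus contains the solution over the whole interval, and one
application of Picard–Lindelöf suffices. -/
theorem exists_pruferAngle {p : ℝ → ℝ} (hpc : ContinuousOn p dom) {m M : ℝ} (hm : 0 < m)
    (hp : ∀ x ∈ dom, p x ∈ Icc m M) (μ : ℝ) : ∃ θ, IsPruferAngle p μ θ := by
  have hM : 0 < M := hm.trans_le ((hp 0 zero_mem_dom).1.trans (hp 0 zero_mem_dom).2)
  set L : NNReal := ⟨1 / (4 * m) + 4 * |μ| * M, by positivity⟩ with hL
  have hLv : (L : ℝ) = 1 / (4 * m) + 4 * |μ| * M := rfl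
  have hpl : IsPicardLindelof (pruferField p μ) (tmin := 0) (tmax := 2 * Real.pi)
      ⟨0, zero_mem_dom⟩ (0 : ℝ) (L * Real.toNNReal (2 * Real.pi)) 0 L L := by
    refine ⟨fun t ht => ?_, fun x _ => ?_, fun t ht x _ => ?_, ?_⟩
    · refine LipschitzOnWith.of_dist_le_mul fun a _ b _ => ?_
      rw [Real.dist_eq, Real.dist_eq, hLv]
      exact pruferField_dist_le hm (hp t ht) le_rfl a b
    · unfold pruferField
      refine ((continuousOn_const.div (continuousOn_const.mul hpc) fun t ht => ?_)).add
        ((continuousOn_const.mul hpc).mul continuousOn_const)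
      exact mul_ne_zero four_ne_zero (hm.trans_le (hp t ht).1).ne'
    · have hpt := hp t ht
      have hp0 := hm.trans_le hpt.1
      rw [Real.norm_eq_abs, hLv]
      refine (abs_add_le _ _).trans (add_le_add ?_ ?_)
      · rw [abs_of_nonneg (by positivity)]
        exact div_le_div₀ zero_le_one (Real.sin_sq_le_one x) (by linarith) (by linarith [hpt.1])
      · rw [abs_mul, abs_mul, abs_mul, abs_of_pos hp0, abs_of_pos (by norm_num : (0 : ℝ) < 4),
          abs_of_nonneg (sq_nonneg (Real.cos x))]
        calc 4 * |μ| * p t * Real.cos x ^ 2 ≤ 4 * |μ| * p t * 1 := by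
              gcongr; exact Real.cos_sq_le_one x
          _ ≤ 4 * |μ| * M := by rw [mul_one]; gcongr; exact hpt.2
    · simp [Real.two_pi_pos.le]
  obtain ⟨θ, h0, hθ⟩ := hpl.exists_eq_forall_mem_Icc_hasDerivWithinAt₀
  exact ⟨θ, hθ, h0⟩

theorem IsPruferAngle.continuousOn {p θ : ℝ → ℝ} {μ : ℝ} (h : IsPruferAngle p μ θ) :
    ContinuousOn θ dom := fun x hx => (h.hasDeriv x hx).continuousWithinAt

theorem hasDerivWithinAt_Ici_of_dom {f : ℝ → ℝ} {f' x : ℝ} (h : HasDerivWithinAt f f' dom x)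
    (hx : x ∈ Ico 0 (2 * Real.pi)) : HasDerivWithinAt f f' (Ici x) x :=
  h.mono_of_mem_nhdsWithin
    (mem_of_superset (Icc_mem_nhdsGE hx.2) (Icc_subset_Icc_left hx.1))

/-- Lipschitz dependence of the final Prüfer angle on the spectral parameter. -/
theorem pruferAngle_lipschitz {p : ℝ → ℝ} {m M : ℝ} (hm : 0 < m)
    (hp : ∀ x ∈ dom, p x ∈ Icc m M) (B : ℝ) :
    ∃ C, 0 ≤ C ∧ ∀ μ ν θ φ, |μ| ≤ B → IsPruferAngle p μ θ → IsPruferAngle p ν φ →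
      |θ (2 * Real.pi) - φ (2 * Real.pi)| ≤ C * |μ - ν| := by
  have hM : 0 < M := hm.trans_le ((hp 0 zero_mem_dom).1.trans (hp 0 zero_mem_dom).2)
  by_cases hB : 0 ≤ B
  swap
  · exact ⟨0, le_rfl, fun μ ν θ φ hμ => absurd ((abs_nonneg μ).trans hμ) hB⟩
  set K : NNReal := ⟨1 / (4 * m) + 4 * B * M, by positivity⟩ with hK
  have hKv : (K : ℝ) = 1 / (4 * m) + 4 * B * M := rfl
  have hKpos : (0 : ℝ) < K := by rw [hKv]; positivity
  refine ⟨4 * M / K * (Real.exp (K * (2 * Real.pi)) - 1), ?_, ?_⟩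
  · have : 1 ≤ Real.exp (K * (2 * Real.pi)) := Real.one_le_exp (by positivity)
    exact mul_nonneg (by positivity) (by linarith)
  intro μ ν θ φ hμ hθ hφ
  -- Grönwall, with `φ` treated as an approximate trajectory of the field of `μ`. The two fields
  -- differ by at most `4 * M * |μ - ν|`, and only the field of `μ` needs a Lipschitz constant.
  have key := dist_le_of_approx_trajectories_ODE_of_mem (a := 0) (b := 2 * Real.pi)
    (v := pruferField p μ) (s := fun _ => univ) (K := K)
    (f := θ) (f' := fun x => pruferField p μ x (θ x))
    (g := φ) (g' := fun x => pruferField p ν x (φ x)) (εf := 0) (εg := 4 * M * |μ - ν|) (δ := 0)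
    (fun t ht => LipschitzOnWith.of_dist_le_mul fun a _ b _ => by
      rw [Real.dist_eq, Real.dist_eq, hKv]
      exact pruferField_dist_le hm (hp t (Ico_subset_Icc_self ht)) hμ a b)
    hθ.continuousOn
    (fun t ht => hasDerivWithinAt_Ici_of_dom (hθ.hasDeriv t (Ico_subset_Icc_self ht)) ht)
    (fun t _ => by simp) (fun _ _ => mem_univ _)
    hφ.continuousOn
    (fun t ht => hasDerivWithinAt_Ici_of_dom (hφ.hasDeriv t (Ico_subset_Icc_self ht)) ht)
    (fun t ht => by
      have hpt := hp t (Ico_subset_Icc_self ht)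
      have hp0 := hm.trans_le hpt.1
      have : pruferField p ν t (φ t) - pruferField p μ t (φ t)
          = 4 * p t * Real.cos (φ t) ^ 2 * (ν - μ) := by unfold pruferField; ring
      rw [Real.dist_eq, this, abs_mul, abs_sub_comm ν μ, abs_of_nonneg (by positivity)]
      refine mul_le_mul_of_nonneg_right ?_ (abs_nonneg _)
      calc 4 * p t * Real.cos (φ t) ^ 2 ≤ 4 * p t * 1 := by
            gcongr; exact Real.cos_sq_le_one _
        _ ≤ 4 * M := by rw [mul_one]; gcongr; exact hpt.2)
    (fun _ _ => mem_univ _) (by simp [hθ.zero, hφ.zero]) (2 * Real.pi) two_pi_mem_dom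
  rw [Real.dist_eq, gronwallBound_of_K_ne_0 hKpos.ne'] at key
  refine key.trans (le_of_eq ?_)
  simp only [zero_add, zero_mul, sub_zero]
  ring

/-- The solution of the Sturm--Liouville equation with a given Prüfer angle. -/
theorem IsPruferAngle.exists_solution {p θ : ℝ → ℝ} {μ : ℝ} (h : IsPruferAngle p μ θ)
    (hpc : ContinuousOn p dom) (hp : ∀ x ∈ dom, 0 < p x) :
    ∃ R : ℝ → ℝ, (∀ x, 0 < R x) ∧
      (∀ x ∈ dom, HasDerivWithinAt (fun x => R x * Real.cos (θ x))
        (-(R x * Real.sin (θ x) / 4) / p x) dom x) ∧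
      (∀ x ∈ dom, HasDerivWithinAt (fun x => -(R x * Real.sin (θ x) / 4))
        (-(μ * p x * (R x * Real.cos (θ x)))) dom x) := by
  -- This function is the logarithmic derivative of the amplitude R, obtained by eliminating θ' from
  -- the equation for η.
  have hc : ContinuousOn (fun x => Real.sin (θ x) * Real.cos (θ x) *
      (4 * μ * p x - 1 / (4 * p x))) dom := by
    refine ((Real.continuous_sin.comp_continuousOn h.continuousOn).mul
      (Real.continuous_cos.comp_continuousOn h.continuousOn)).mul
      ((continuousOn_const.mul hpc).sub (continuousOn_const.div (continuousOn_const.mul hpc) ?_))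
    intro x hx
    have := hp x hx
    positivity
  obtain ⟨F, -, hF⟩ := exists_primitive hc
  refine ⟨fun x => Real.exp (F x), fun x => Real.exp_pos _, fun x hx => ?_, fun x hx => ?_⟩
  · have hx0 := hp x hx
    refine ((hF x hx).exp.mul (h.hasDeriv x hx).cos).congr_deriv ?_
    unfold pruferField
    field_simp
    linear_combination (-Real.sin (θ x)) * Real.sin_sq_add_cos_sq (θ x)
  · have hx0 := hp x hx
    refine (((hF x hx).exp.mul (h.hasDeriv x hx).sin).div_const 4).neg.congr_deriv ?_
    unfold pruferField
    field_simp
    linear_combination (-16 * p x ^ 2 * μ * Real.cos (θ x)) * Real.sin_sq_add_cos_sq (θ x)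

theorem pruferField_pos {p : ℝ → ℝ} {μ x : ℝ} (hp : 0 < p x) (hμ : 0 < μ) (θ : ℝ) :
    0 < pruferField p μ x θ := by
  unfold pruferField
  by_cases hc : Real.cos θ = 0
  · have hs : Real.sin θ ^ 2 = 1 := by rw [Real.sin_sq, hc]; norm_num
    rw [hs, hc]; positivity
  · have : 0 < Real.cos θ ^ 2 := by positivity
    positivity

theorem IsPruferAngle.strictMonoOn {p θ : ℝ → ℝ} {μ : ℝ} (h : IsPruferAngle p μ θ)
    (hp : ∀ x ∈ dom, 0 < p x) (hμ : 0 < μ) : StrictMonoOn θ dom := by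
  refine strictMonoOn_of_deriv_pos (convex_Icc _ _) h.continuousOn fun x hx => ?_
  rw [interior_Icc] at hx
  have hx' := Ioo_subset_Icc_self hx
  rw [((h.hasDeriv x hx').hasDerivAt (Icc_mem_nhds hx.1 hx.2)).deriv]
  exact pruferField_pos (hp x hx') hμ _

theorem hasDerivAt_cos_quarter (x : ℝ) :
    HasDerivAt (fun x : ℝ => Real.cos (x / 4)) (-(Real.sin (x / 4) / 4)) x := by
  refine ((hasDerivAt_id x).div_const 4).cos.congr_deriv ?_
  simp only [id]; ring

theorem hasDerivAt_sin_quarter (x : ℝ) :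
    HasDerivAt (fun x : ℝ => Real.sin (x / 4)) (Real.cos (x / 4) / 4) x := by
  refine ((hasDerivAt_id x).div_const 4).sin.congr_deriv ?_
  simp only [id]; ring

theorem cos_two_pi_quarter : Real.cos (2 * Real.pi / 4) = 0 := by
  rw [show 2 * Real.pi / 4 = Real.pi / 2 by ring, Real.cos_pi_div_two]

/-! ### Existence, minimality and bounds for the principal eigenvalue -/

/-- Upper bound for a spectral parameter that admits a positive solution. -/
theorem spectral_le_of_positive_solution {p η y : ℝ → ℝ} {m M μ : ℝ} (hm : 0 < m)
    (hp : ∀ x ∈ dom, p x ∈ Icc m M)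
    (hη : ∀ x ∈ dom, HasDerivWithinAt η (y x / p x) dom x)
    (hy : ∀ x ∈ dom, HasDerivWithinAt y (-(μ * p x * η x)) dom x)
    (hpos : ∀ x ∈ Ico 0 (2 * Real.pi), 0 < η x)
    (hend : η (2 * Real.pi) ≠ 0 ∨ y (2 * Real.pi) ≠ 0) (hy0 : y 0 = 0) :
    μ ≤ M / (16 * m) := by
  by_contra! hcon
  have hM : 0 < M := hm.trans_le ((hp 0 zero_mem_dom).1.trans (hp 0 zero_mem_dom).2)
  have hμ : 0 < μ := (by positivity : 0 < M / (16 * m)).trans hcon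
  -- The comparison problem has constant weight `M` and solution cos(x/4). The theorem would make
  -- this solution vanish identically, but it equals 1 at 0.
  have := sturm_picone Real.two_pi_pos (η := fun x => Real.cos (x / 4))
    (y := fun x => -(M * Real.sin (x / 4) / 4)) (P := fun _ => M) (Q := fun _ => M / 16)
    (Q₁ := fun x => μ * p x) hη hy
    (fun x _ => ((hasDerivAt_cos_quarter x).congr_deriv (by field_simp)).hasDerivWithinAt)
    (fun x _ => ((((hasDerivAt_sin_quarter x).const_mul M).div_const 4).neg.congr_deriv
      (by ring)).hasDerivWithinAt)
    hpos hend (fun x hx => hm.trans_le (hp x hx).1) (fun x hx => (hp x hx).2)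
    (fun x hx => by
      rw [div_lt_iff₀ (by positivity)] at hcon
      have : μ * m ≤ μ * p x := mul_le_mul_of_nonneg_left (hp x hx).1 hμ.le
      linarith) hy0 (by simp) cos_two_pi_quarter 0 zero_mem_dom
  simp at this

theorem IsPruferAngle.cos_pos {p θ : ℝ → ℝ} {μ : ℝ} (h : IsPruferAngle p μ θ)
    (hp : ∀ x ∈ dom, 0 < p x) (hμ : 0 < μ) (hθ : θ (2 * Real.pi) ≤ Real.pi / 2) :
    ∀ x ∈ Ico 0 (2 * Real.pi), 0 < Real.cos (θ x) := by
  intro x hx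
  have hx' := Ico_subset_Icc_self hx
  have hmono := h.strictMonoOn hp hμ
  refine Real.cos_pos_of_mem_Ioo ⟨?_, (hmono hx' two_pi_mem_dom hx.2).trans_le hθ⟩
  have := hmono.monotoneOn zero_mem_dom hx' hx.1
  rw [h.zero] at this
  linarith [Real.pi_pos]

/-- If the angle stayed below π/2, the solution would be positive up to and including the endpoint,
which is impossible for so large a spectral parameter. -/
theorem IsPruferAngle.pi_div_two_le {p θ : ℝ → ℝ} {m M μ : ℝ} (h : IsPruferAngle p μ θ)
    (hpc : ContinuousOn p dom) (hm : 0 < m) (hp : ∀ x ∈ dom, p x ∈ Icc m M)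
    (hμ : M / (16 * m) < μ) : Real.pi / 2 ≤ θ (2 * Real.pi) := by
  have hM : 0 < M := hm.trans_le ((hp 0 zero_mem_dom).1.trans (hp 0 zero_mem_dom).2)
  have hμ0 : 0 < μ := (by positivity : 0 < M / (16 * m)).trans hμ
  have hp0 : ∀ x ∈ dom, 0 < p x := fun x hx => hm.trans_le (hp x hx).1
  by_contra! hcon
  obtain ⟨R, hR, h1, h2⟩ := h.exists_solution hpc hp0
  have hend : 0 < Real.cos (θ (2 * Real.pi)) := by
    refine Real.cos_pos_of_mem_Ioo ⟨?_, hcon⟩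
    have := (h.strictMonoOn hp0 hμ0).monotoneOn zero_mem_dom two_pi_mem_dom Real.two_pi_pos.le
    rw [h.zero] at this
    linarith [Real.pi_pos]
  exact hμ.not_ge (spectral_le_of_positive_solution hm hp h1 h2
    (fun x hx => mul_pos (hR x) (h.cos_pos hp0 hμ0 hcon.le x hx))
    (Or.inl (mul_pos (hR _) hend).ne') (by simp [h.zero]))

/-- Shooting: the final angle depends continuously on `μ`, is 0 at `μ = 0`, and is at least π/2 for
large `μ`. The intermediate value theorem finds the value π/2. -/
theorem exists_isPrincipal {p : ℝ → ℝ} {m M : ℝ} (hpc : ContinuousOn p dom) (hm : 0 < m)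
    (hp : ∀ x ∈ dom, p x ∈ Icc m M) : ∃ μ, IsPrincipal p μ := by
  have hM : 0 < M := hm.trans_le ((hp 0 zero_mem_dom).1.trans (hp 0 zero_mem_dom).2)
  choose θ hθ using exists_pruferAngle hpc hm hp
  set μ₁ : ℝ := M / (16 * m) + 1 with hμ₁
  have hμ₁0 : 0 ≤ μ₁ := by positivity
  obtain ⟨C, hC0, hC⟩ := pruferAngle_lipschitz hm hp μ₁
  have habs : ∀ μ ∈ Icc 0 μ₁, |μ| ≤ μ₁ := fun μ hμ => (abs_of_nonneg hμ.1).trans_le hμ.2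
  have hcont : ContinuousOn (fun μ => θ μ (2 * Real.pi)) (Icc 0 μ₁) := by
    refine LipschitzOnWith.continuousOn (K := ⟨C, hC0⟩) (LipschitzOnWith.of_dist_le_mul ?_)
    intro μ hμ ν _
    exact hC μ ν _ _ (habs μ hμ) (hθ μ) (hθ ν)
  have hzero : θ 0 (2 * Real.pi) = 0 := by
    have h0 : IsPruferAngle p 0 (fun _ => 0) :=
      ⟨fun x _ => (hasDerivWithinAt_const x dom (0 : ℝ)).congr_deriv (by simp [pruferField]), rfl⟩
    have := hC 0 0 _ _ (by simpa using hμ₁0) (hθ 0) h0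
    simpa using this
  have hlarge : Real.pi / 2 ≤ θ μ₁ (2 * Real.pi) :=
    (hθ μ₁).pi_div_two_le hpc hm hp (by linarith)
  obtain ⟨μ, hμ, hval⟩ := intermediate_value_Icc hμ₁0 hcont
    (show Real.pi / 2 ∈ Icc (θ 0 (2 * Real.pi)) (θ μ₁ (2 * Real.pi)) from
      ⟨by rw [hzero]; positivity, hlarge⟩)
  refine ⟨μ, lt_of_le_of_ne hμ.1 ?_, θ μ, hθ μ, hval⟩
  rintro rfl
  simp only [hzero] at hval
  linarith [Real.pi_pos]

theorem IsPrincipal.exists_eigenfunction {p : ℝ → ℝ} {μ : ℝ} (h : IsPrincipal p μ)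
    (hpc : ContinuousOn p dom) (hp : ∀ x ∈ dom, 0 < p x) :
    ∃ η y : ℝ → ℝ, IsSturmEigenfunction p μ η y ∧ (∀ x ∈ Ico 0 (2 * Real.pi), 0 < η x) ∧
      y (2 * Real.pi) ≠ 0 := by
  obtain ⟨hμ, θ, hθ, hend⟩ := h
  obtain ⟨R, hR, h1, h2⟩ := hθ.exists_solution hpc hp
  have hpos : ∀ x ∈ Ico 0 (2 * Real.pi), 0 < R x * Real.cos (θ x) := fun x hx =>
    mul_pos (hR x) (hθ.cos_pos hp hμ hend.le x hx)
  refine ⟨_, fun x => -(R x * Real.sin (θ x) / 4), ⟨fun x hx => ?_, fun x hx => ?_, ?_, ?_,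
    ⟨0, zero_mem_dom, (hpos 0 ⟨le_rfl, Real.two_pi_pos⟩).ne'⟩⟩, hpos, ?_⟩
  · exact (h1 x hx).congr_deriv (by rw [smul_eq_mul]; ring)
  · exact (h2 x hx).congr_deriv (by rw [smul_eq_mul]; ring)
  · simp [hθ.zero]
  · simp [hend]
  · simp [hend, (hR (2 * Real.pi)).ne']

theorem IsSturmEigenfunction.hasDeriv_div {p η y : ℝ → ℝ} {μ : ℝ}
    (h : IsSturmEigenfunction p μ η y) :
    ∀ x ∈ dom, HasDerivWithinAt η (y x / p x) dom x := fun x hx =>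
  (h.hasDeriv x hx).congr_deriv (by rw [smul_eq_mul]; ring)

theorem IsSturmEigenfunction.hasDeriv_quasi_mul {p η y : ℝ → ℝ} {μ : ℝ}
    (h : IsSturmEigenfunction p μ η y) :
    ∀ x ∈ dom, HasDerivWithinAt y (-(μ * p x * η x)) dom x := fun x hx =>
  (h.hasDeriv_quasi x hx).congr_deriv (by rw [smul_eq_mul]; ring)

/-- Comparison with the positive principal eigenfunction. The sign condition at 0 admits Neumann and
Dirichlet data alike; the Dirichlet case is needed in `IsPrincipal.le_of_exp_mul`. -/
theorem IsPrincipal.le_of_solution {p η y : ℝ → ℝ} {μ ν : ℝ} (h : IsPrincipal p μ)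
    (hpc : ContinuousOn p dom) (hp : ∀ x ∈ dom, 0 < p x)
    (hη : ∀ x ∈ dom, HasDerivWithinAt η (y x / p x) dom x)
    (hy : ∀ x ∈ dom, HasDerivWithinAt y (-(ν * p x * η x)) dom x)
    (h0 : 0 ≤ y 0 * η 0) (hend : η (2 * Real.pi) = 0) (hne : ∃ x ∈ dom, η x ≠ 0) : μ ≤ ν := by
  obtain ⟨η₁, y₁, h₁, hpos, hy₁⟩ := h.exists_eigenfunction hpc hp
  by_contra! hcon
  obtain ⟨x, hx, hxne⟩ := hne
  exact hxne (sturm_picone Real.two_pi_pos (Q₁ := fun x => μ * p x) (Q := fun x => ν * p x)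
    h₁.hasDeriv_div h₁.hasDeriv_quasi_mul hη hy hpos (Or.inr hy₁) hp (fun x _ => le_rfl)
    (fun x hx => mul_lt_mul_of_pos_right hcon (hp x hx)) h₁.quasi_zero h0 hend x hx)

/-- Comparison with cos(x/4) in both directions, for the constant weights `M` and `m`. It supplies
the a priori closeness to 1/16 that the perturbation expansion starts from. -/
theorem IsPrincipal.mem_Icc {p : ℝ → ℝ} {m M μ : ℝ} (h : IsPrincipal p μ)
    (hpc : ContinuousOn p dom) (hm : 0 < m) (hp : ∀ x ∈ dom, p x ∈ Icc m M) :
    μ ∈ Icc (m / (16 * M)) (M / (16 * m)) := by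
  have hM : 0 < M := hm.trans_le ((hp 0 zero_mem_dom).1.trans (hp 0 zero_mem_dom).2)
  have hp0 : ∀ x ∈ dom, 0 < p x := fun x hx => hm.trans_le (hp x hx).1
  obtain ⟨η, y, h₁, hpos, hy⟩ := h.exists_eigenfunction hpc hp0
  refine ⟨?_, spectral_le_of_positive_solution hm hp h₁.hasDeriv_div h₁.hasDeriv_quasi_mul hpos
    (Or.inr hy) h₁.quasi_zero⟩
  by_contra! hcon
  have := sturm_picone Real.two_pi_pos (η₁ := fun x => Real.cos (x / 4))
    (y₁ := fun x => -(m * Real.sin (x / 4) / 4)) (p₁ := fun _ => m) (Q₁ := fun _ => m / 16)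
    (Q := fun x => μ * p x)
    (fun x _ => ((hasDerivAt_cos_quarter x).congr_deriv (by field_simp)).hasDerivWithinAt)
    (fun x _ => ((((hasDerivAt_sin_quarter x).const_mul m).div_const 4).neg.congr_deriv
      (by ring)).hasDerivWithinAt)
    h₁.hasDeriv_div h₁.hasDeriv_quasi_mul
    (fun x hx => Real.cos_pos_of_mem_Ioo ⟨by linarith [hx.1, Real.pi_pos], by linarith [hx.2]⟩)
    (Or.inr (by
      rw [show 2 * Real.pi / 4 = Real.pi / 2 by ring, Real.sin_pi_div_two]
      simp [hm.ne']))
    (fun _ _ => hm) (fun x hx => (hp x hx).1)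
    (fun x hx => by
      rw [lt_div_iff₀ (by positivity)] at hcon
      have : μ * p x ≤ μ * M := mul_le_mul_of_nonneg_left (hp x hx).2 h.1.le
      linarith) (by simp) (by simp [h₁.quasi_zero]) h₁.end_zero
  obtain ⟨x, hx, hne⟩ := h₁.ne_zero
  exact hne (this x hx)

/-! ### Reality and minimality for complex eigenfunctions -/

/-- A function with nonnegative derivative and equal boundary values has zero derivative. -/
theorem deriv_eq_zero_of_boundary {G g : ℝ → ℝ} (hG : ∀ x ∈ dom, HasDerivWithinAt G (g x) dom x)
    (hg : ∀ x ∈ dom, 0 ≤ g x) (h : G (2 * Real.pi) = G 0) : ∀ x ∈ dom, g x = 0 := by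
  have hmono : MonotoneOn G dom := by
    refine monotoneOn_of_deriv_nonneg (convex_Icc _ _)
      (fun x hx => (hG x hx).continuousWithinAt) ?_ ?_ <;>
    · intro x hx
      rw [interior_Icc] at hx
      have hx' := Ioo_subset_Icc_self hx
      have hd := (hG x hx').hasDerivAt (Icc_mem_nhds hx.1 hx.2)
      first
        | exact hd.differentiableAt.differentiableWithinAt
        | rw [hd.deriv]; exact hg x hx'
  have hconst : ∀ x ∈ dom, G x = G 0 := fun x hx =>
    le_antisymm (h ▸ hmono hx two_pi_mem_dom hx.2) (hmono zero_mem_dom hx hx.1)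
  intro x hx
  have h0 : HasDerivWithinAt G 0 dom x :=
    (hasDerivWithinAt_const x dom (G 0)).congr hconst (hconst x hx)
  exact (uniqueDiffOn_Icc Real.two_pi_pos x hx).eq_deriv _ (hG x hx) h0

theorem hasDerivWithinAt_re {f : ℝ → ℂ} {f' : ℂ} {s : Set ℝ} {x : ℝ}
    (h : HasDerivWithinAt f f' s x) : HasDerivWithinAt (fun x => (f x).re) f'.re s x :=
  (Complex.reCLM.hasFDerivAt (x := f x)).comp_hasDerivWithinAt x h

theorem hasDerivWithinAt_im {f : ℝ → ℂ} {f' : ℂ} {s : Set ℝ} {x : ℝ}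
    (h : HasDerivWithinAt f f' s x) : HasDerivWithinAt (fun x => (f x).im) f'.im s x :=
  (Complex.imCLM.hasFDerivAt (x := f x)).comp_hasDerivWithinAt x h

/-- Green's identity: the Wronskian of the real and imaginary parts, divided by `μ.im`, has
derivative p|η|² and vanishes at both ends. -/
theorem IsSturmEigenfunction.im_eq_zero {p : ℝ → ℝ} {η y : ℝ → ℂ} {μ : ℂ}
    (h : IsSturmEigenfunction p μ η y) (hp : ∀ x ∈ dom, 0 < p x) : μ.im = 0 := by
  by_contra hμ
  have hG : ∀ x ∈ dom, HasDerivWithinAt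
      (fun x => ((y x).re * (η x).im - (y x).im * (η x).re) / μ.im)
      (p x * ((η x).re ^ 2 + (η x).im ^ 2)) dom x := by
    intro x hx
    have h1 := h.hasDeriv x hx
    have h2 := h.hasDeriv_quasi x hx
    have hpx := (hp x hx).ne'
    refine ((((hasDerivWithinAt_re h2).mul (hasDerivWithinAt_im h1)).sub
      ((hasDerivWithinAt_im h2).mul (hasDerivWithinAt_re h1))).div_const μ.im).congr_deriv ?_
    simp only [Complex.neg_re, Complex.neg_im, Complex.mul_re, Complex.mul_im, Complex.smul_re,
      Complex.smul_im, smul_eq_mul]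
    field_simp
    ring
  have hz := deriv_eq_zero_of_boundary hG
    (fun x hx => mul_nonneg (hp x hx).le (by positivity)) (by simp [h.quasi_zero, h.end_zero])
  obtain ⟨x, hx, hne⟩ := h.ne_zero
  have h3 := (mul_eq_zero.1 (hz x hx)).resolve_left (hp x hx).ne'
  refine hne (Complex.ext ?_ ?_)
  · rw [Complex.zero_re]; nlinarith [sq_nonneg (η x).re, sq_nonneg (η x).im]
  · rw [Complex.zero_im]; nlinarith [sq_nonneg (η x).re, sq_nonneg (η x).im]

/-- As `ν` is real, the real and imaginary parts of the eigenfunction solve the same real equation,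
and at least one of them is nontrivial. -/
theorem IsPrincipal.le_re {p : ℝ → ℝ} {η y : ℝ → ℂ} {μ : ℝ} {ν : ℂ} (h : IsPrincipal p μ)
    (hpc : ContinuousOn p dom) (hp : ∀ x ∈ dom, 0 < p x)
    (hη : IsSturmEigenfunction p ν η y) : μ ≤ ν.re := by
  have him := hη.im_eq_zero hp
  obtain ⟨x, hx, hne⟩ := hη.ne_zero
  by_cases hre : (η x).re = 0
  · refine h.le_of_solution hpc hp (η := fun x => (η x).im) (y := fun x => (y x).im)
      (fun z hz => (hasDerivWithinAt_im (hη.hasDeriv z hz)).congr_deriv ?_)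
      (fun z hz => (hasDerivWithinAt_im (hη.hasDeriv_quasi z hz)).congr_deriv ?_)
      (by simp [hη.quasi_zero]) (by simp [hη.end_zero])
      ⟨x, hx, fun h0 => hne (Complex.ext hre h0)⟩
    · simp only [Complex.smul_im, smul_eq_mul]; ring
    · simp only [Complex.neg_im, Complex.mul_im, Complex.smul_im, Complex.smul_re, smul_eq_mul,
        him]; ring
  · refine h.le_of_solution hpc hp (η := fun x => (η x).re) (y := fun x => (y x).re)
      (fun z hz => (hasDerivWithinAt_re (hη.hasDeriv z hz)).congr_deriv ?_)
      (fun z hz => (hasDerivWithinAt_re (hη.hasDeriv_quasi z hz)).congr_deriv ?_)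
      (by simp [hη.quasi_zero]) (by simp [hη.end_zero]) ⟨x, hx, hre⟩
    · simp only [Complex.smul_re, smul_eq_mul]; ring
    · simp only [Complex.neg_re, Complex.mul_re, Complex.smul_im, Complex.smul_re, smul_eq_mul,
        him]; ring

theorem IsSturmEigenfunction.ofReal {p η y : ℝ → ℝ} {μ : ℝ} (h : IsSturmEigenfunction p μ η y) :
    IsSturmEigenfunction p (μ : ℂ) (fun x => (η x : ℂ)) (fun x => (y x : ℂ)) where
  hasDeriv x hx := (h.hasDeriv x hx).ofReal_comp.congr_deriv (by simp)
  hasDeriv_quasi x hx := (h.hasDeriv_quasi x hx).ofReal_comp.congr_deriv (by simp)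
  quasi_zero := by simp [h.quasi_zero]
  end_zero := by simp [h.end_zero]
  ne_zero := by
    obtain ⟨x, hx, hne⟩ := h.ne_zero
    exact ⟨x, hx, by simpa using hne⟩

/-! ### Perturbation expansion of the principal eigenvalue -/

theorem integral_eq_sub_of_dom {E : Type*} [NormedAddCommGroup E] [NormedSpace ℝ E]
    [CompleteSpace E] {f f' : ℝ → E} (hf : ∀ x ∈ dom, HasDerivWithinAt f (f' x) dom x)
    (hc : ContinuousOn f' dom) {x : ℝ} (hx : x ∈ dom) : ∫ t in (0 : ℝ)..x, f' t = f x - f 0 := by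
  have hsub : Icc 0 x ⊆ dom := Icc_subset_Icc_right hx.2
  refine intervalIntegral.integral_eq_sub_of_hasDerivAt_of_le hx.1
    (fun z hz => ((hf z (hsub hz)).continuousWithinAt).mono hsub) (fun z hz => ?_) ?_
  · exact (hf z (hsub (Ioo_subset_Icc_self hz))).hasDerivAt
      (Icc_mem_nhds hz.1 (hz.2.trans_le hx.2))
  · exact (hc.mono hsub).intervalIntegrable_of_Icc hx.1

theorem integral_cos_half : ∫ x in (0 : ℝ)..(2 * Real.pi), Real.cos (x / 2) = 0 := by
  rw [intervalIntegral.integral_comp_div (fun x => Real.cos x) two_ne_zero]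
  simp

/-- Second-order accuracy of the first-order perturbation formula for the principal eigenvalue. -/
theorem IsPrincipal.abs_sub_le {f : ℝ → ℝ} {μ δ : ℝ} (hf : ContinuousOn f dom) (hδ0 : 0 ≤ δ)
    (hδ : δ ≤ 1 / 2) (hfδ : ∀ x ∈ dom, |f x| ≤ δ)
    (h : IsPrincipal (fun x => Real.exp (f x)) μ) :
    |μ - 1 / 16 + (1 / (16 * Real.pi)) * ∫ x in (0 : ℝ)..(2 * Real.pi), f x * Real.cos (x / 2)|
      ≤ 30 * δ ^ 2 := by
  have hpc : ContinuousOn (fun x => Real.exp (f x)) dom := Real.continuous_exp.comp_continuousOn hf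
  have hexp : ∀ t : ℝ, |t| ≤ δ → |Real.exp t - 1| ≤ 2 * δ ∧ |Real.exp t - 1 - t| ≤ δ ^ 2 := by
    intro t ht
    refine ⟨(Real.abs_exp_sub_one_le (by linarith)).trans (by linarith), ?_⟩
    refine (Real.abs_exp_sub_one_sub_id_le (by linarith)).trans ?_
    rw [← sq_abs]
    exact pow_le_pow_left₀ (abs_nonneg t) ht 2
  have hμ := h.mem_Icc hpc (Real.exp_pos (-δ)) (M := Real.exp δ) fun x hx =>
    ⟨Real.exp_le_exp.2 (abs_le.1 (hfδ x hx)).1, Real.exp_le_exp.2 (abs_le.1 (hfδ x hx)).2⟩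
  set κ : ℝ := μ - 1 / 16 with hκ
  -- The a priori bounds are exp(±2δ)/16, and |exp(±2δ) - 1| ≤ 4δ.
  have hκδ : |κ| ≤ δ / 4 := by
    have h1 := Real.abs_exp_sub_one_le (x := 2 * δ) (by rw [abs_of_nonneg (by linarith)]; linarith)
    have h2 := Real.abs_exp_sub_one_le (x := -(2 * δ))
      (by rw [abs_neg, abs_of_nonneg (by linarith)]; linarith)
    rw [abs_neg] at h2
    rw [abs_of_nonneg (by linarith : 0 ≤ 2 * δ)] at h1 h2
    have e1 : Real.exp δ / (16 * Real.exp (-δ)) = Real.exp (2 * δ) / 16 := by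
      rw [two_mul, Real.exp_add, Real.exp_neg]; field_simp
    have e2 : Real.exp (-δ) / (16 * Real.exp δ) = Real.exp (-(2 * δ)) / 16 := by
      rw [show -(2 * δ) = -δ + -δ by ring, Real.exp_add, Real.exp_neg]; field_simp
    rw [e1, e2] at hμ
    rw [abs_le] at h1 h2 ⊢
    constructor <;> linarith [hμ.1, hμ.2, h1.1, h1.2, h2.1, h2.2]
  obtain ⟨-, θ, hθ, hend⟩ := h
  set A : ℝ → ℝ := fun x => (Real.exp (-f x) - 1) / 4 with hA
  set B : ℝ → ℝ := fun x => 4 * κ * Real.exp (f x) + (Real.exp (f x) - 1) / 4 with hB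
  have hfield : ∀ x, pruferField (fun x => Real.exp (f x)) μ x (θ x) - 1 / 4
      = A x * Real.sin (θ x) ^ 2 + B x * Real.cos (θ x) ^ 2 := by
    intro x
    have hμκ : μ = κ + 1 / 16 := by rw [hκ]; ring
    have := Real.exp_pos (f x)
    simp only [pruferField, hA, hB, hμκ, Real.exp_neg]
    field_simp
    linear_combination (16 * Real.exp (f x)) * Real.sin_sq_add_cos_sq (θ x)
  have hAb : ∀ x ∈ dom, |A x| ≤ δ / 2 ∧ |A x + f x / 4| ≤ δ ^ 2 / 4 := by
    intro x hx
    obtain ⟨h1, h2⟩ := hexp (-f x) (by rw [abs_neg]; exact hfδ x hx)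
    constructor
    · simp only [hA, abs_div]; rw [abs_of_pos (by norm_num : (0 : ℝ) < 4)]; linarith
    · have : A x + f x / 4 = (Real.exp (-f x) - 1 - -f x) / 4 := by simp only [hA]; ring
      rw [this, abs_div, abs_of_pos (by norm_num : (0 : ℝ) < 4)]; linarith
  have hBb : ∀ x ∈ dom, |B x| ≤ 5 / 2 * δ ∧ |B x - 4 * κ - f x / 4| ≤ 9 / 4 * δ ^ 2 := by
    intro x hx
    obtain ⟨h1, h2⟩ := hexp (f x) (hfδ x hx)
    have h3 : |κ * (Real.exp (f x) - 1)| ≤ δ / 4 * (2 * δ) := by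
      rw [abs_mul]; exact mul_le_mul hκδ h1 (abs_nonneg _) (by linarith)
    have h4 : δ ^ 2 ≤ δ / 2 := by nlinarith
    rw [abs_le] at h1 h2 h3 hκδ
    simp only [hB]
    constructor <;> rw [abs_le] <;> constructor <;> nlinarith
  have hnear : ∀ x ∈ dom, |θ x - x / 4| ≤ 6 * Real.pi * δ := by
    intro x hx
    -- The angular speed differs from 1/4 by at most δ/2 + 5δ/2 = 3δ, over a length of at most 2π.
    have := (convex_Icc (0 : ℝ) (2 * Real.pi)).norm_image_sub_le_of_norm_hasDerivWithin_le
      (f := fun x => θ x - x / 4)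
      (f' := fun x => pruferField (fun x => Real.exp (f x)) μ x (θ x) - 1 / 4) (C := 3 * δ)
      (fun x hx => (hθ.hasDeriv x hx).sub ((hasDerivWithinAt_id x dom).div_const 4))
      (fun x hx => by
        rw [hfield, Real.norm_eq_abs]
        refine (abs_add_le _ _).trans ?_
        rw [abs_mul, abs_mul, abs_of_nonneg (sq_nonneg (Real.sin (θ x))),
          abs_of_nonneg (sq_nonneg (Real.cos (θ x)))]
        have h1 := mul_le_mul (hAb x hx).1 (Real.sin_sq_le_one (θ x)) (sq_nonneg _) (by linarith)
        have h2 := mul_le_mul (hBb x hx).1 (Real.cos_sq_le_one (θ x)) (sq_nonneg _) (by linarith)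
        linarith)
      zero_mem_dom hx
    simp only [hθ.zero, zero_div, sub_zero, Real.norm_eq_abs] at this
    rw [abs_of_nonneg hx.1] at this
    have h2 := mul_le_mul_of_nonneg_left hx.2 (by linarith : 0 ≤ 3 * δ)
    linarith
  -- `g` is the part of θ' - 1/4 that is linear in `κ` and `f`, with θ replaced by x/4. This
  -- replacement costs only O(δ²), because the coefficients `A` and `B` are already O(δ).
  set g : ℝ → ℝ := fun x => 2 * κ + 2 * κ * Real.cos (x / 2) + 1 / 4 * (f x * Real.cos (x / 2))
    with hg
  set P : ℝ → ℝ := fun x => pruferField (fun x => Real.exp (f x)) μ x (θ x) with hP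
  have hPc : ContinuousOn P dom := by
    have hθc := hθ.continuousOn
    refine ((Real.continuous_sin.comp_continuousOn hθc).pow 2 |>.div
      (continuousOn_const.mul hpc) fun x _ => ?_).add
      ((continuousOn_const.mul hpc).mul ((Real.continuous_cos.comp_continuousOn hθc).pow 2))
    exact mul_ne_zero four_ne_zero (Real.exp_ne_zero _)
  have hcosc : ContinuousOn (fun x : ℝ => Real.cos (x / 2)) dom := by fun_prop
  have hgc : ContinuousOn g dom :=
    (continuousOn_const.add (continuousOn_const.mul hcosc)).add
      (continuousOn_const.mul (hf.mul hcosc))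
  have hint : ∀ {F : ℝ → ℝ}, ContinuousOn F dom → IntervalIntegrable F volume 0 (2 * Real.pi) :=
    fun hF => hF.intervalIntegrable_of_Icc Real.two_pi_pos.le
  have hpt : ∀ x ∈ dom, |P x - 1 / 4 - g x| ≤ 60 * δ ^ 2 := by
    intro x hx
    have hc2 : Real.cos (x / 2) = Real.cos (x / 4) ^ 2 - Real.sin (x / 4) ^ 2 := by
      rw [show x / 2 = 2 * (x / 4) by ring, Real.cos_two_mul']
    have hsc := Real.sin_sq_add_cos_sq (x / 4)
    have e : P x - 1 / 4 - g x = A x * (Real.sin (θ x) ^ 2 - Real.sin (x / 4) ^ 2)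
        + (A x + f x / 4) * Real.sin (x / 4) ^ 2
        + B x * (Real.cos (θ x) ^ 2 - Real.cos (x / 4) ^ 2)
        + (B x - 4 * κ - f x / 4) * Real.cos (x / 4) ^ 2 := by
      simp only [hP, hg]
      rw [hfield, hc2]
      linear_combination (2 * κ) * hsc
    rw [e]
    have n := hnear x hx
    have b1 : |A x * (Real.sin (θ x) ^ 2 - Real.sin (x / 4) ^ 2)| ≤ δ / 2 * (6 * Real.pi * δ) := by
      rw [abs_mul]
      exact mul_le_mul (hAb x hx).1 ((sin_sq_lipschitz _ _).trans n) (abs_nonneg _) (by linarith)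
    have b2 : |(A x + f x / 4) * Real.sin (x / 4) ^ 2| ≤ δ ^ 2 / 4 * 1 := by
      rw [abs_mul, abs_of_nonneg (sq_nonneg (Real.sin (x / 4)))]
      exact mul_le_mul (hAb x hx).2 (Real.sin_sq_le_one _) (sq_nonneg _) (by positivity)
    have b3 : |B x * (Real.cos (θ x) ^ 2 - Real.cos (x / 4) ^ 2)|
        ≤ 5 / 2 * δ * (6 * Real.pi * δ) := by
      rw [abs_mul]
      exact mul_le_mul (hBb x hx).1 ((cos_sq_lipschitz _ _).trans n) (abs_nonneg _) (by linarith)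
    have b4 : |(B x - 4 * κ - f x / 4) * Real.cos (x / 4) ^ 2| ≤ 9 / 4 * δ ^ 2 * 1 := by
      rw [abs_mul, abs_of_nonneg (sq_nonneg (Real.cos (x / 4)))]
      exact mul_le_mul (hBb x hx).2 (Real.cos_sq_le_one _) (sq_nonneg _) (by positivity)
    have hπ : Real.pi * δ ^ 2 ≤ 3.15 * δ ^ 2 :=
      mul_le_mul_of_nonneg_right Real.pi_lt_d2.le (sq_nonneg δ)
    refine (abs_add_le _ _).trans ?_
    refine (add_le_add_left ((abs_add_le _ _).trans
      (add_le_add_left (abs_add_le _ _) _)) _).trans ?_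
    -- The four bounds add up to (18π + 5/2)δ², which is below 60δ².
    nlinarith
  have hI := intervalIntegral.norm_integral_le_of_norm_le_const (a := 0) (b := 2 * Real.pi)
    (f := fun x => P x - 1 / 4 - g x) (C := 60 * δ ^ 2) (fun x hx => by
      rw [uIoc_of_le Real.two_pi_pos.le] at hx
      exact hpt x (Ioc_subset_Icc_self hx))
  -- The eigenvalue condition: the total increase of the angle is π/2, equal to the integral of the
  -- unperturbed speed 1/4. Hence the integral of `g` is O(δ²), which determines `κ`.
  have hPI : ∫ x in (0 : ℝ)..(2 * Real.pi), P x = Real.pi / 2 := by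
    rw [integral_eq_sub_of_dom hθ.hasDeriv hPc two_pi_mem_dom, hend, hθ.zero, sub_zero]
  have hgI : ∫ x in (0 : ℝ)..(2 * Real.pi), g x = 4 * Real.pi * κ
      + 1 / 4 * ∫ x in (0 : ℝ)..(2 * Real.pi), f x * Real.cos (x / 2) := by
    simp only [hg]
    have i1 : IntervalIntegrable (fun x => 2 * κ + 2 * κ * Real.cos (x / 2)) volume 0
        (2 * Real.pi) := hint (continuousOn_const.add (continuousOn_const.mul hcosc))
    have i2 : IntervalIntegrable (fun x => 1 / 4 * (f x * Real.cos (x / 2))) volume 0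
        (2 * Real.pi) := hint (continuousOn_const.mul (hf.mul hcosc))
    have i3 : IntervalIntegrable (fun x => 2 * κ * Real.cos (x / 2)) volume 0 (2 * Real.pi) :=
      hint (continuousOn_const.mul hcosc)
    rw [intervalIntegral.integral_add i1 i2,
      intervalIntegral.integral_add (hint continuousOn_const) i3,
      intervalIntegral.integral_const, intervalIntegral.integral_const_mul,
      intervalIntegral.integral_const_mul, integral_cos_half]
    simp only [smul_eq_mul]
    ring
  rw [intervalIntegral.integral_sub ((hint hPc).sub (hint continuousOn_const)) (hint hgc),
    intervalIntegral.integral_sub (hint hPc) (hint continuousOn_const), hPI, hgI,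
    intervalIntegral.integral_const, Real.norm_eq_abs, sub_zero, abs_of_pos Real.two_pi_pos,
    smul_eq_mul] at hI
  set J := ∫ x in (0 : ℝ)..(2 * Real.pi), f x * Real.cos (x / 2) with hJ
  have e : Real.pi / 2 - 2 * Real.pi * (1 / 4) - (4 * Real.pi * κ + 1 / 4 * J)
      = -(4 * Real.pi) * (κ + 1 / (16 * Real.pi) * J) := by
    have := Real.pi_pos
    field_simp
    ring
  rw [e, abs_mul, abs_neg, abs_of_pos (by positivity)] at hI
  have h4 : 0 < 4 * Real.pi := by positivity
  refine le_of_mul_le_mul_left ?_ h4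
  linarith

/-- The function exp(-cx/2) sin(x/2) is an explicit Dirichlet solution with spectral parameter 1/4 +
c²/4. The bound serves strengths `c` that are too large for the perturbation expansion. -/
theorem IsPrincipal.le_of_exp_mul {c μ : ℝ} (h : IsPrincipal (fun x => Real.exp (c * x)) μ) :
    μ ≤ 1 / 4 + c ^ 2 / 4 := by
  have he : ∀ a x : ℝ, HasDerivAt (fun x => Real.exp (a * x)) (Real.exp (a * x) * a) x :=
    fun a x => by simpa using ((hasDerivAt_id x).const_mul a).exp
  have hs : ∀ x : ℝ, HasDerivAt (fun x => Real.sin (x / 2)) (Real.cos (x / 2) * (1 / 2)) x :=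
    fun x => ((hasDerivAt_id x).div_const 2).sin
  have hc : ∀ x : ℝ, HasDerivAt (fun x => Real.cos (x / 2)) (-Real.sin (x / 2) * (1 / 2)) x :=
    fun x => ((hasDerivAt_id x).div_const 2).cos
  have hmul : ∀ x : ℝ, Real.exp (c * x) = Real.exp (c / 2 * x) * Real.exp (c / 2 * x) := fun x => by
    rw [← Real.exp_add]; ring_nf
  have hinv : ∀ x : ℝ, Real.exp (-(c / 2) * x) = (Real.exp (c / 2 * x))⁻¹ := fun x => by
    rw [← Real.exp_neg]; ring_nf
  refine h.le_of_solution (by fun_prop) (fun x _ => Real.exp_pos _)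
    (η := fun x => Real.exp (-(c / 2) * x) * Real.sin (x / 2))
    (y := fun x => Real.exp (c / 2 * x) *
      (Real.cos (x / 2) * (1 / 2) - c / 2 * Real.sin (x / 2)))
    (fun x _ => (((he _ x).mul (hs x)).congr_deriv ?_).hasDerivWithinAt)
    (fun x _ => (((he _ x).mul (((hc x).mul_const (1 / 2)).sub
      ((hs x).const_mul (c / 2)))).congr_deriv ?_).hasDerivWithinAt) (by simp) (by simp) ?_
  · have := Real.exp_pos (c / 2 * x)
    rw [hmul, hinv]
    field_simp
    ring
  · have := Real.exp_pos (c / 2 * x)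
    rw [hmul, hinv]
    simp only [Pi.sub_apply]
    field_simp
    ring
  · exact ⟨Real.pi, ⟨Real.pi_pos.le, by linarith [Real.pi_pos]⟩, by simp [Real.exp_ne_zero]⟩

theorem integral_id_mul_cos_half :
    ∫ x in (0 : ℝ)..(2 * Real.pi), x * Real.cos (x / 2) = -8 := by
  have hF : ∀ x : ℝ, HasDerivAt (fun x => 2 * (x * Real.sin (x / 2)) + 4 * Real.cos (x / 2))
      (x * Real.cos (x / 2)) x := fun x => by
    refine ((((hasDerivAt_id x).mul ((hasDerivAt_id x).div_const 2).sin).const_mul 2).add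
      (((hasDerivAt_id x).div_const 2).cos.const_mul 4)).congr_deriv ?_
    simp only [id]; ring
  rw [intervalIntegral.integral_eq_sub_of_hasDerivAt (fun x _ => hF x)
    (by apply Continuous.intervalIntegrable; fun_prop)]
  rw [show 2 * Real.pi / 2 = Real.pi by ring]
  simp
  norm_num

/-- For a constant profile the perturbation formula holds uniformly in the strength `c ≥ 0`. -/
theorem IsPrincipal.abs_sub_le_of_exp_mul {c μ : ℝ} (hc : 0 ≤ c)
    (h : IsPrincipal (fun x => Real.exp (c * x)) μ) :
    |μ - 1 / 16 - c / (2 * Real.pi)| ≤ (120 * Real.pi ^ 2 + 3) * c ^ 2 := by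
  have hπ := Real.pi_pos
  have hπ3 := Real.pi_gt_three
  -- For small `c` the expansion applies with δ = 2πc, so 30δ² = 120π²c². Otherwise 1 ≤ 16π²c², and
  -- every term, including the crude upper bound for `μ`, is dominated by a multiple of c².
  by_cases hcs : 2 * Real.pi * c ≤ 1 / 2
  · have := IsPrincipal.abs_sub_le (f := fun x => c * x) (by fun_prop) (by positivity) hcs
      (fun x hx => by
        rw [abs_of_nonneg (mul_nonneg hc hx.1)]
        linarith [mul_le_mul_of_nonneg_left hx.2 hc]) h
    simp only [mul_assoc c] at this
    rw [intervalIntegral.integral_const_mul, integral_id_mul_cos_half] at this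
    have e : μ - 1 / 16 - c / (2 * Real.pi) = μ - 1 / 16 + 1 / (16 * Real.pi) * (c * -8) := by
      field_simp; ring
    rw [e]
    refine this.trans ?_
    nlinarith [sq_nonneg c]
  · push Not at hcs
    have h1 := h.le_of_exp_mul
    have h0 := h.1
    have hc0 : 0 < c := by
      by_contra! hneg
      nlinarith
    have h2 : 1 ≤ 16 * Real.pi ^ 2 * c ^ 2 := by nlinarith
    have h3 : c / (2 * Real.pi) ≤ 2 * c ^ 2 := by
      rw [div_le_iff₀ (by positivity)]; nlinarith
    have h4 : 0 ≤ c / (2 * Real.pi) := by positivity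
    have h5 : 0 ≤ Real.pi ^ 2 * c ^ 2 := by positivity
    rw [abs_le]
    constructor <;> nlinarith

/-! ### Bounded profiles and integrating factors -/

/-- Essentially bounded profiles on the platoon domain. -/
structure IsBoundedProfile (k : ℝ → ℝ) (B : ℝ) : Prop where
  aestronglyMeasurable : AEStronglyMeasurable k domainMeasure
  nonneg : 0 ≤ B
  bound : ∀ᵐ x ∂domainMeasure, |k x| ≤ B

/-- Primitive of a profile. -/
noncomputable def profilePrimitive (k : ℝ → ℝ) (x : ℝ) : ℝ := ∫ t in (0 : ℝ)..x, k t

theorem IsBoundedProfile.ae_bound {k : ℝ → ℝ} {B : ℝ} (hk : IsBoundedProfile k B) :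
    ∀ᵐ x, x ∈ dom → |k x| ≤ B := (ae_restrict_iff' measurableSet_Icc).1 hk.bound

theorem IsBoundedProfile.intervalIntegrable {k : ℝ → ℝ} {B : ℝ} (hk : IsBoundedProfile k B) :
    IntervalIntegrable k volume 0 (2 * Real.pi) := by
  rw [intervalIntegrable_iff_integrableOn_Icc_of_le Real.two_pi_pos.le]
  have hfin : IsFiniteMeasure domainMeasure := by
    unfold domainMeasure; infer_instance
  exact Integrable.of_bound hk.aestronglyMeasurable B hk.bound

theorem intervalIntegrable_mono_dom {E : Type*} [NormedAddCommGroup E] {f : ℝ → E}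
    (hf : IntervalIntegrable f volume 0 (2 * Real.pi)) {x y : ℝ} (hx : x ∈ dom) (hy : y ∈ dom) :
    IntervalIntegrable f volume x y := by
  refine hf.mono_set ?_
  rw [uIcc_of_le Real.two_pi_pos.le]
  exact uIcc_subset_Icc hx hy

theorem IsBoundedProfile.abs_primitive_sub_le {k : ℝ → ℝ} {B : ℝ} (hk : IsBoundedProfile k B)
    {x y : ℝ} (hx : x ∈ dom) (hy : y ∈ dom) :
    |profilePrimitive k x - profilePrimitive k y| ≤ B * |x - y| := by
  have hi := hk.intervalIntegrable
  unfold profilePrimitive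
  rw [intervalIntegral.integral_interval_sub_left (intervalIntegrable_mono_dom hi zero_mem_dom hx)
    (intervalIntegrable_mono_dom hi zero_mem_dom hy)]
  refine (Real.norm_eq_abs _).symm.trans_le ?_
  refine intervalIntegral.norm_integral_le_of_norm_le_const_ae ?_
  filter_upwards [hk.ae_bound] with t ht hmem
  exact ht (uIcc_subset_Icc hy hx (uIoc_subset_uIcc hmem))

theorem IsBoundedProfile.abs_primitive_le {k : ℝ → ℝ} {B : ℝ} (hk : IsBoundedProfile k B)
    {x : ℝ} (hx : x ∈ dom) : |profilePrimitive k x| ≤ B * (2 * Real.pi) := by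
  have h := hk.abs_primitive_sub_le hx zero_mem_dom
  have h0 : profilePrimitive k 0 = 0 := by simp [profilePrimitive]
  rw [h0, sub_zero, sub_zero, abs_of_nonneg hx.1] at h
  exact h.trans (mul_le_mul_of_nonneg_left hx.2 hk.nonneg)

theorem IsBoundedProfile.lipschitzOnWith {k : ℝ → ℝ} {B : ℝ} (hk : IsBoundedProfile k B) :
    LipschitzOnWith (Real.toNNReal B) (profilePrimitive k) dom :=
  LipschitzOnWith.of_dist_le_mul fun x hx y hy => by
    rw [Real.dist_eq, Real.dist_eq, Real.coe_toNNReal B hk.nonneg]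
    exact hk.abs_primitive_sub_le hx hy

theorem IsBoundedProfile.continuousOn {k : ℝ → ℝ} {B : ℝ} (hk : IsBoundedProfile k B) :
    ContinuousOn (profilePrimitive k) dom := hk.lipschitzOnWith.continuousOn

/-- The primitive is Lipschitz with bounded range, and the exponential is Lipschitz on that range.
-/
theorem IsBoundedProfile.absolutelyContinuous_exp {k : ℝ → ℝ} {B : ℝ}
    (hk : IsBoundedProfile k B) (c : ℝ) {x : ℝ} (hx : x ∈ dom) :
    AbsolutelyContinuousOnInterval (fun x => Real.exp (c * profilePrimitive k x)) 0 x := by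
  have hcd : ContDiffOn ℝ 1 (fun z : ℝ => Real.exp (c * z))
      (Icc (-(B * (2 * Real.pi))) (B * (2 * Real.pi))) := by fun_prop
  obtain ⟨L, hL⟩ := hcd.exists_lipschitzOnWith (by decide) (convex_Icc _ _) isCompact_Icc
  have hmaps : MapsTo (profilePrimitive k) dom (Icc (-(B * (2 * Real.pi))) (B * (2 * Real.pi))) :=
    fun z hz => abs_le.1 (hk.abs_primitive_le hz)
  have hcomp := hL.comp hk.lipschitzOnWith hmaps
  refine (hcomp.mono ?_).absolutelyContinuousOnInterval
  rw [uIcc_of_le hx.1]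
  exact Icc_subset_Icc_right hx.2

/-- Product rule for the integrating factor `exp (c ∫ k)` and a primitive. -/
theorem IsBoundedProfile.exp_mul_eq_real {k : ℝ → ℝ} {B : ℝ} (hk : IsBoundedProfile k B) (c : ℝ)
    {f g : ℝ → ℝ} (hg : IntervalIntegrable g volume 0 (2 * Real.pi))
    (hf : ∀ x ∈ dom, f x = f 0 + ∫ t in (0 : ℝ)..x, g t) {x : ℝ} (hx : x ∈ dom) :
    Real.exp (c * profilePrimitive k x) * f x =
      f 0 + ∫ t in (0 : ℝ)..x, Real.exp (c * profilePrimitive k t) * (g t + c * k t * f t) := by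
  set F : ℝ → ℝ := fun x => f 0 + ∫ t in (0 : ℝ)..x, g t with hF
  have hsub : uIcc 0 x ⊆ dom := uIcc_subset_Icc zero_mem_dom hx
  have hg' := intervalIntegrable_mono_dom hg zero_mem_dom hx
  have hFac : AbsolutelyContinuousOnInterval F 0 x := by
    have h1 : AbsolutelyContinuousOnInterval (fun _ : ℝ => f 0) 0 x :=
      (LipschitzWith.const (f 0)).lipschitzOnWith.absolutelyContinuousOnInterval
    exact h1.add (hg'.absolutelyContinuousOnInterval_intervalIntegral left_mem_uIcc)
  have hprod := (hk.absolutelyContinuous_exp c hx).mul hFac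
  have hftc := hprod.integral_deriv_eq_sub
  have hK0 : profilePrimitive k 0 = 0 := by simp [profilePrimitive]
  have hcongr : ∫ t in (0 : ℝ)..x,
      deriv ((fun x => Real.exp (c * profilePrimitive k x)) * F) t =
      ∫ t in (0 : ℝ)..x, Real.exp (c * profilePrimitive k t) * (g t + c * k t * f t) := by
    refine intervalIntegral.integral_congr_ae ?_
    filter_upwards [hg'.ae_hasDerivAt_integral,
      (intervalIntegrable_mono_dom hk.intervalIntegrable zero_mem_dom hx).ae_hasDerivAt_integral] with t h1 h2 ht
    have ht' := uIoc_subset_uIcc ht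
    have d1 : HasDerivAt F (g t) t := (h1 ht' 0 left_mem_uIcc).const_add (f 0)
    have d2 : HasDerivAt (fun x => Real.exp (c * profilePrimitive k x))
        (Real.exp (c * profilePrimitive k t) * (c * k t)) t :=
      ((h2 ht' 0 left_mem_uIcc).const_mul c).exp
    rw [(d2.mul d1).deriv, hf t (hsub ht')]
    ring
  rw [hcongr] at hftc
  rw [hftc, hf x hx]
  simp [hF, hK0]

theorem continuousOn_of_eq_integral {E : Type*} [NormedAddCommGroup E] [NormedSpace ℝ E]
    {f g : ℝ → E}
    (hg : IntervalIntegrable g volume 0 (2 * Real.pi))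
    (hf : ∀ x ∈ dom, f x = f 0 + ∫ t in (0 : ℝ)..x, g t) : ContinuousOn f dom := by
  refine ContinuousOn.congr (continuousOn_const.add ?_) hf
  have := intervalIntegral.continuousOn_primitive_interval' hg left_mem_uIcc
  rwa [uIcc_of_le Real.two_pi_pos.le] at this

theorem IsBoundedProfile.intervalIntegrable_exp_mul {k : ℝ → ℝ} {B : ℝ}
    (hk : IsBoundedProfile k B) (c : ℝ) {f g : ℝ → ℂ}
    (hg : IntervalIntegrable g volume 0 (2 * Real.pi)) (hf : ContinuousOn f dom) :
    IntervalIntegrable (fun t => (Real.exp (c * profilePrimitive k t) : ℂ) *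
      (g t + (c * k t : ℝ) * f t)) volume 0 (2 * Real.pi) := by
  have hdom : uIcc 0 (2 * Real.pi) = dom := uIcc_of_le Real.two_pi_pos.le
  have hkc : IntervalIntegrable (fun t => ((c * k t : ℝ) : ℂ)) volume 0 (2 * Real.pi) :=
    ⟨(hk.intervalIntegrable.const_mul c).1.ofReal, (hk.intervalIntegrable.const_mul c).2.ofReal⟩
  refine (hg.add (hkc.mul_continuousOn (hdom ▸ hf))).continuousOn_mul ?_
  rw [hdom]
  exact Complex.continuous_ofReal.comp_continuousOn
    (Real.continuous_exp.comp_continuousOn (continuousOn_const.mul hk.continuousOn))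

theorem IsBoundedProfile.exp_mul_eq {k : ℝ → ℝ} {B : ℝ} (hk : IsBoundedProfile k B) (c : ℝ)
    {f g : ℝ → ℂ} (hg : IntervalIntegrable g volume 0 (2 * Real.pi))
    (hf : ∀ x ∈ dom, f x = f 0 + ∫ t in (0 : ℝ)..x, g t) {x : ℝ} (hx : x ∈ dom) :
    (Real.exp (c * profilePrimitive k x) : ℂ) * f x =
      f 0 + ∫ t in (0 : ℝ)..x,
        (Real.exp (c * profilePrimitive k t) : ℂ) * (g t + (c * k t : ℝ) * f t) := by
  have hint := intervalIntegrable_mono_dom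
    (hk.intervalIntegrable_exp_mul c hg (continuousOn_of_eq_integral hg hf)) zero_mem_dom hx
  have key : ∀ L : ℂ →L[ℝ] ℝ, (∀ (r : ℝ) (z : ℂ), L (r * z) = r * L z) →
      L ((Real.exp (c * profilePrimitive k x) : ℂ) * f x) =
      L (f 0 + ∫ t in (0 : ℝ)..x,
        (Real.exp (c * profilePrimitive k t) : ℂ) * (g t + (c * k t : ℝ) * f t)) := by
    intro L hL
    have hgL : IntervalIntegrable (fun t => L (g t)) volume 0 (2 * Real.pi) :=
      ⟨L.integrable_comp hg.1, L.integrable_comp hg.2⟩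
    have := hk.exp_mul_eq_real c hgL (f := fun t => L (f t)) (fun z hz => by
      rw [L.intervalIntegral_comp_comm (intervalIntegrable_mono_dom hg zero_mem_dom hz), ← map_add, ← hf z hz]) hx
    rw [hL, this, map_add, ← L.intervalIntegral_comp_comm hint]
    simp only [hL, map_add]
  refine Complex.ext (key Complex.reCLM fun r z => ?_) (key Complex.imCLM fun r z => ?_)
  · exact Complex.re_ofReal_mul r z
  · exact Complex.im_ofReal_mul r z

/-! ### Reduction of the mistuned problem to Sturm–Liouville form -/

section Reduction

variable {k₀ b₀ ε : ℝ} {N : ℕ} {k : ℝ → ℝ} {B : ℝ}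

/-- Strength of the drift in the Sturm--Liouville form of the mistuned eigenvalue problem. -/
noncomputable def driftStrength (k₀ : ℝ) (N : ℕ) (ε : ℝ) : ℝ := 2 * ε * meanDensity N / k₀

/-- Weight of the Sturm--Liouville form of the mistuned eigenvalue problem. -/
noncomputable def sturmWeight (k₀ : ℝ) (N : ℕ) (k : ℝ → ℝ) (ε x : ℝ) : ℝ :=
  Real.exp (driftStrength k₀ N ε * profilePrimitive k x)

theorem meanDensity_pos (hN : 0 < N) : 0 < meanDensity N := by
  unfold meanDensity
  have := Real.pi_pos
  positivity

theorem IsBoundedProfile.continuousOn_sturmWeight (hk : IsBoundedProfile k B) :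
    ContinuousOn (sturmWeight k₀ N k ε) dom :=
  Real.continuous_exp.comp_continuousOn (continuousOn_const.mul hk.continuousOn)

theorem sturmWeight_pos (x : ℝ) : 0 < sturmWeight k₀ N k ε x := Real.exp_pos _

/-- In the derivative of pψ the profile cancels almost everywhere, leaving the continuous function
-νpη. Hence pψ is differentiable at every point, and the almost-everywhere equation becomes a
classical one. -/
theorem IsEigenfunctionND.exists_sturm (hk₀ : 0 < k₀) (hN : 0 < N) (hk : IsBoundedProfile k B)
    {s : ℂ} {η : ℝ → ℂ} (h : IsEigenfunctionND k₀ b₀ ε N k (fun x => -k x) s η) :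
    ∃ (ν : ℂ) (y : ℝ → ℂ), s ^ 2 + b₀ * s = -((k₀ / meanDensity N ^ 2 : ℝ) * ν) ∧
      IsSturmEigenfunction (sturmWeight k₀ N k ε) ν η y := by
  obtain ⟨hne, ψ, g, hη, hg, hψ, hode, hψ0, hend⟩ := h
  have hρ := meanDensity_pos hN
  set a : ℝ := k₀ / meanDensity N ^ 2 with ha
  have ha0 : 0 < a := by positivity
  have haC : (a : ℂ) ≠ 0 := by exact_mod_cast ha0.ne'
  set c := driftStrength k₀ N ε with hc
  set ν : ℂ := -(s ^ 2 + b₀ * s) / a with hν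
  set p := sturmWeight k₀ N k ε with hp
  have hpos : ∀ x, 0 < p x := sturmWeight_pos
  refine ⟨ν, fun x => (p x : ℂ) * ψ x, by rw [hν]; field_simp, ?_⟩
  have hηc : ContinuousOn η dom := fun x hx => (hη x hx).continuousWithinAt
  have hpc : ContinuousOn p dom := hk.continuousOn_sturmWeight
  have hfc : ContinuousOn (fun x => -(ν * (p x • η x))) dom :=
    (continuousOn_const.mul (hpc.smul hηc)).neg
  have hode' : ∀ᵐ x, x ∈ dom → g x + (c * k x : ℝ) * ψ x = -(ν * η x) := by
    filter_upwards [(ae_restrict_iff' measurableSet_Icc).1 hode] with x hx hmem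
    have h1 := hx hmem
    have h2 : ε * ((k x - -k x) / meanDensity N) = a * (c * k x) := by
      rw [ha, hc, driftStrength]; field_simp; ring
    have h3 : (ε : ℂ) * (((k x - -k x) / meanDensity N : ℝ) : ℂ) = a * ((c * k x : ℝ) : ℂ) := by
      exact_mod_cast h2
    rw [add_neg_cancel, zero_div, Complex.ofReal_zero, zero_mul, add_zero, ← mul_assoc, h3] at h1
    refine mul_left_cancel₀ haC ?_
    rw [hν]
    field_simp
    linear_combination -h1
  have hy : ∀ x ∈ dom, (p x : ℂ) * ψ x = ∫ t in (0 : ℝ)..x, -(ν * (p t • η t)) := by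
    intro x hx
    have := hk.exp_mul_eq c hg hψ hx
    rw [hψ0, zero_add] at this
    refine this.trans (intervalIntegral.integral_congr_ae ?_)
    filter_upwards [hode'] with t ht hmem
    rw [ht (uIcc_subset_Icc zero_mem_dom hx (uIoc_subset_uIcc hmem)), Complex.real_smul]
    simp only [hp, sturmWeight]
    ring
  refine ⟨fun x hx => ?_, fun x hx => ?_, by simp [hψ0], hend, hne⟩
  · refine (hη x hx).congr_deriv ?_
    have : (p x : ℂ) ≠ 0 := by exact_mod_cast (hpos x).ne'
    rw [Complex.real_smul, Complex.ofReal_inv]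
    field_simp
  · exact (hasDerivWithinAt_integral hfc x hx).congr hy (hy x hx)

/-- The converse passage uses the reciprocal factor exp(-c∫k) to recover η' and an integrable second
derivative from the quasi-derivative. -/
theorem IsSturmEigenfunction.isEigenfunctionND (hk₀ : 0 < k₀) (hN : 0 < N)
    (hk : IsBoundedProfile k B) {s ν : ℂ} {η y : ℝ → ℂ}
    (hs : s ^ 2 + b₀ * s = -((k₀ / meanDensity N ^ 2 : ℝ) * ν))
    (h : IsSturmEigenfunction (sturmWeight k₀ N k ε) ν η y) :
    IsEigenfunctionND k₀ b₀ ε N k (fun x => -k x) s η := by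
  have hρ := meanDensity_pos hN
  set a : ℝ := k₀ / meanDensity N ^ 2 with ha
  set c := driftStrength k₀ N ε with hc
  set p := sturmWeight k₀ N k ε with hp
  have hpos : ∀ x, 0 < p x := sturmWeight_pos
  have hpC : ∀ x, (p x : ℂ) ≠ 0 := fun x => by exact_mod_cast (hpos x).ne'
  have hpc : ContinuousOn p dom := hk.continuousOn_sturmWeight
  have hηc : ContinuousOn η dom := fun x hx => (h.hasDeriv x hx).continuousWithinAt
  have hyc : ContinuousOn y dom := fun x hx => (h.hasDeriv_quasi x hx).continuousWithinAt
  have hfc : ContinuousOn (fun x => -(ν * (p x • η x))) dom :=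
    (continuousOn_const.mul (hpc.smul hηc)).neg
  have hfi := hfc.intervalIntegrable_of_Icc (μ := volume) Real.two_pi_pos.le
  have hyI : ∀ x ∈ dom, y x = y 0 + ∫ t in (0 : ℝ)..x, -(ν * (p t • η t)) := fun x hx => by
    rw [integral_eq_sub_of_dom h.hasDeriv_quasi hfc hx]; ring
  have hexp : ∀ x, (Real.exp (-c * profilePrimitive k x) : ℂ) = (p x : ℂ)⁻¹ := fun x => by
    rw [neg_mul, Real.exp_neg, Complex.ofReal_inv]; rfl
  refine ⟨h.ne_zero, fun x => (p x : ℂ)⁻¹ * y x,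
    fun t => (Real.exp (-c * profilePrimitive k t) : ℂ) *
      (-(ν * (p t • η t)) + (-c * k t : ℝ) * y t), fun x hx => ?_,
    hk.intervalIntegrable_exp_mul (-c) hfi hyc, fun x hx => ?_, ae_of_all _ fun x => ?_,
    by simp [h.quasi_zero], h.end_zero⟩
  · refine (h.hasDeriv x hx).congr_deriv ?_
    rw [Complex.real_smul, Complex.ofReal_inv]
  · have := hk.exp_mul_eq (-c) hfi hyI hx
    rw [hexp] at this
    simpa [h.quasi_zero] using this
  · have h2 : ε * ((k x - -k x) / meanDensity N) = a * (c * k x) := by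
      rw [ha, hc, driftStrength]; field_simp; ring
    have h3 : (ε : ℂ) * (((k x - -k x) / meanDensity N : ℝ) : ℂ) = a * ((c * k x : ℝ) : ℂ) := by
      exact_mod_cast h2
    have h4 := hpC x
    beta_reduce
    rw [add_neg_cancel, zero_div, Complex.ofReal_zero, zero_mul, add_zero, ← mul_assoc (ε : ℂ), h3,
      hexp, Complex.real_smul, ← add_mul, hs, ← ha]
    push_cast
    field_simp
    ring

/-- The least stable eigenvalue as a function of `a₀² μ`. -/
noncomputable def dampedRoot (b₀ m : ℝ) : ℝ := (-b₀ + Real.sqrt (b₀ ^ 2 - 4 * m)) / 2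

theorem dampedRoot_eq {m : ℝ} (hm : 4 * m ≤ b₀ ^ 2) :
    dampedRoot b₀ m ^ 2 + b₀ * dampedRoot b₀ m = -m := by
  have := Real.sq_sqrt (sub_nonneg.2 hm)
  unfold dampedRoot
  linear_combination this / 4

/-- Every ν is real and at least `μ`. A nonreal root then has real part -b₀/2, which lies left of
the damped root. On the real axis s² + b₀s increases to the right of -b₀/2, so a real root beyond
the damped root would need ν < μ. -/
theorem isLeastStable_of_isPrincipal (hk₀ : 0 < k₀) (hN : 0 < N)
    (hk : IsBoundedProfile k B) {μ : ℝ} (h : IsPrincipal (sturmWeight k₀ N k ε) μ)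
    (hμ : 4 * (k₀ / meanDensity N ^ 2 * μ) < b₀ ^ 2) :
    IsLeastStable (eigenvaluesND k₀ b₀ ε N k (fun x => -k x))
      (dampedRoot b₀ (k₀ / meanDensity N ^ 2 * μ)) := by
  have hρ := meanDensity_pos hN
  have hpc : ContinuousOn (sturmWeight k₀ N k ε) dom := hk.continuousOn_sturmWeight
  have hp : ∀ x ∈ dom, 0 < sturmWeight k₀ N k ε x := fun x _ => sturmWeight_pos x
  have hσ := dampedRoot_eq hμ.le
  have hsq : 0 < Real.sqrt (b₀ ^ 2 - 4 * (k₀ / meanDensity N ^ 2 * μ)) :=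
    Real.sqrt_pos.2 (sub_pos.2 hμ)
  have hσb : -b₀ / 2 < dampedRoot b₀ (k₀ / meanDensity N ^ 2 * μ) := by
    unfold dampedRoot; linarith
  have ha0 : 0 < k₀ / meanDensity N ^ 2 := by positivity
  set a : ℝ := k₀ / meanDensity N ^ 2 with ha
  set σ := dampedRoot b₀ (a * μ) with hσd
  constructor
  · obtain ⟨η, y, hη, -, -⟩ := h.exists_eigenfunction hpc hp
    refine ⟨_, hη.ofReal.isEigenfunctionND hk₀ hN hk ?_⟩
    rw [← ha]
    exact_mod_cast hσ
  · rintro z ⟨η, hη⟩ hz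
    obtain ⟨ν, y, hs, hst⟩ := hη.exists_sturm hk₀ hN hk
    rw [← ha] at hs
    have him := hst.im_eq_zero hp
    have hre := h.le_re hpc hp hst
    have h1 := congrArg Complex.im hs
    have h2 := congrArg Complex.re hs
    simp only [sq, Complex.add_re, Complex.add_im, Complex.mul_re, Complex.mul_im, Complex.neg_re,
      Complex.neg_im, Complex.ofReal_re, Complex.ofReal_im, him] at h1 h2
    have h3 : z.im * (2 * z.re + b₀) = 0 := by linear_combination h1
    rcases mul_eq_zero.1 h3 with h4 | h4
    · rw [h4] at h2
      have h5 : a * μ ≤ a * ν.re := mul_le_mul_of_nonneg_left hre ha0.le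
      rcases lt_trichotomy z.re σ with hlt | heq | hgt
      · exact hlt
      · exact absurd (Complex.ext (by simpa using heq) (by simpa using h4)) hz
      · exfalso
        have : 0 < (z.re - σ) * (z.re + σ + b₀) :=
          mul_pos (by linarith) (by linarith)
        nlinarith
    · linarith

theorem sOnePlus_eq (hk₀ : 0 < k₀) (hN : 0 < N)
    (hk : IsBoundedProfile k B) {μ : ℝ} (h : IsPrincipal (sturmWeight k₀ N k ε) μ)
    (hμ : 4 * (k₀ / meanDensity N ^ 2 * μ) < b₀ ^ 2) :
    sOnePlus k₀ b₀ N k ε = dampedRoot b₀ (k₀ / meanDensity N ^ 2 * μ) :=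
  (isLeastStable_of_isPrincipal hk₀ hN hk h hμ).sSup_eq

theorem IsBoundedProfile.exists_isPrincipal (hk : IsBoundedProfile k B) :
    ∃ μ, IsPrincipal (sturmWeight k₀ N k ε) μ := by
  set c := |driftStrength k₀ N ε| * (B * (2 * Real.pi)) with hc
  refine Platoon.exists_isPrincipal (m := Real.exp (-c)) (M := Real.exp c)
    hk.continuousOn_sturmWeight (Real.exp_pos _) fun x hx => ?_
  have : |driftStrength k₀ N ε * profilePrimitive k x| ≤ c := by
    rw [abs_mul]
    exact mul_le_mul_of_nonneg_left (hk.abs_primitive_le hx) (abs_nonneg _)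
  exact ⟨Real.exp_le_exp.2 (abs_le.1 this).1, Real.exp_le_exp.2 (abs_le.1 this).2⟩

end Reduction

/-! ### Expansion of the damped root -/

theorem hasDerivAt_dampedRoot {b₀ m : ℝ} (hm : 4 * m < b₀ ^ 2) :
    HasDerivAt (dampedRoot b₀) (-1 / Real.sqrt (b₀ ^ 2 - 4 * m)) m := by
  have hpos : 0 < b₀ ^ 2 - 4 * m := sub_pos.2 hm
  have hs := Real.sqrt_pos.2 hpos
  refine ((((((hasDerivAt_id m).const_mul 4).const_sub (b₀ ^ 2)).sqrt hpos.ne').const_add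
    (-b₀)).div_const 2).congr_deriv ?_
  simp only [id]
  field_simp
  norm_num

theorem abs_dampedRoot_sub_le {b₀ m₀ m : ℝ} (hb₀ : 0 < b₀) (hm₀ : 4 * m₀ ≤ 3 / 4 * b₀ ^ 2)
    (hm : 4 * m ≤ 3 / 4 * b₀ ^ 2) :
    |dampedRoot b₀ m - dampedRoot b₀ m₀ + (m - m₀) / Real.sqrt (b₀ ^ 2 - 4 * m₀)|
      ≤ 8 / b₀ ^ 3 * (m - m₀) ^ 2 := by
  have hsqrt : ∀ z, 4 * z ≤ 3 / 4 * b₀ ^ 2 → b₀ / 2 ≤ Real.sqrt (b₀ ^ 2 - 4 * z) := fun z hz =>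
    Real.le_sqrt_of_sq_le (by nlinarith)
  have hA := hsqrt m hm
  have hB := hsqrt m₀ hm₀
  have hA2 := Real.sq_sqrt (show 0 ≤ b₀ ^ 2 - 4 * m by nlinarith)
  have hB2 := Real.sq_sqrt (show 0 ≤ b₀ ^ 2 - 4 * m₀ by nlinarith)
  unfold dampedRoot
  set A := Real.sqrt (b₀ ^ 2 - 4 * m)
  set B := Real.sqrt (b₀ ^ 2 - 4 * m₀)
  have hBpos : 0 < B := by linarith
  -- The linearisation error is an exact square over 4B. Dividing the difference of the squared
  -- roots by A + B ≥ b₀ bounds it quadratically in m - m₀.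
  have e : (-b₀ + A) / 2 - (-b₀ + B) / 2 + (m - m₀) / B = -((A - B) ^ 2 / (4 * B)) := by
    field_simp
    linear_combination 2 * hA2 - 2 * hB2
  rw [e, abs_neg, abs_of_nonneg (by positivity)]
  have hdiff : (A - B) * (A + B) = -4 * (m - m₀) := by linear_combination hA2 - hB2
  have hsum : b₀ ^ 2 ≤ (A + B) ^ 2 := by nlinarith
  have h1 : (A - B) ^ 2 * b₀ ^ 2 ≤ 16 * (m - m₀) ^ 2 := by
    calc (A - B) ^ 2 * b₀ ^ 2 ≤ (A - B) ^ 2 * (A + B) ^ 2 :=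
          mul_le_mul_of_nonneg_left hsum (sq_nonneg _)
      _ = 16 * (m - m₀) ^ 2 := by rw [← mul_pow, hdiff]; ring
  calc (A - B) ^ 2 / (4 * B) ≤ (A - B) ^ 2 / (2 * b₀) :=
        div_le_div_of_nonneg_left (sq_nonneg _) (by positivity) (by linarith)
    _ ≤ 8 / b₀ ^ 3 * (m - m₀) ^ 2 := by
        rw [div_mul_eq_mul_div, div_le_div_iff₀ (by positivity) (by positivity)]
        nlinarith [mul_le_mul_of_nonneg_left h1 hb₀.le]

/-- A one-sided derivative from a quadratic remainder bound. -/
theorem hasDerivWithinAt_of_quadratic {g : ℝ → ℝ} {d C τ : ℝ} (hτ : 0 < τ)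
    (h : ∀ ε ∈ Ico 0 τ, |g ε - g 0 - ε * d| ≤ C * ε ^ 2) :
    HasDerivWithinAt g d (Ici 0) 0 := by
  rw [hasDerivWithinAt_iff_isLittleO]
  have hO : (fun ε => g ε - g 0 - (ε - 0) • d) =O[𝓝[Ici 0] 0] fun ε : ℝ => ε ^ 2 := by
    refine Asymptotics.IsBigO.of_bound C ?_
    filter_upwards [Ico_mem_nhdsGE hτ] with ε hε
    simpa using h ε hε
  refine hO.trans_isLittleO ?_
  have : (fun ε : ℝ => ε ^ 2) =o[𝓝 0] fun ε : ℝ => ε ^ 1 :=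
    Asymptotics.isLittleO_pow_pow (by norm_num)
  simpa using this.mono nhdsWithin_le_nhds

/-! ### First-order response to a profile -/

section FirstOrder

variable {k₀ b₀ : ℝ} {N : ℕ} {k : ℝ → ℝ} {B : ℝ}

/-- First-order response functional of a profile. -/
noncomputable def responseIntegral (k : ℝ → ℝ) : ℝ :=
  ∫ x in (0 : ℝ)..(2 * Real.pi), profilePrimitive k x * Real.cos (x / 2)

/-- Proportionality factor between the response functional and the derivative of `s₁⁺`. -/
noncomputable def responseFactor (k₀ b₀ : ℝ) (N : ℕ) : ℝ :=
  k₀ / meanDensity N ^ 2 / Real.sqrt (b₀ ^ 2 - 4 * (k₀ / meanDensity N ^ 2 * (1 / 16))) *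
    (1 / (16 * Real.pi) * driftStrength k₀ N 1)

theorem responseFactor_pos (hk₀ : 0 < k₀) (hN : 0 < N)
    (hb : 4 * (k₀ / meanDensity N ^ 2 * (1 / 16)) < b₀ ^ 2) : 0 < responseFactor k₀ b₀ N := by
  have hρ := meanDensity_pos hN
  have hs := Real.sqrt_pos.2 (sub_pos.2 hb)
  have := Real.pi_pos
  unfold responseFactor driftStrength
  positivity

theorem IsBoundedProfile.quadratic_principal (hk₀ : 0 < k₀) (hN : 0 < N)
    (hk : IsBoundedProfile k B) : ∃ C τ : ℝ, 0 < τ ∧ ∀ ε ∈ Ico 0 τ, ∀ μ,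
      IsPrincipal (sturmWeight k₀ N k ε) μ →
      |μ - 1 / 16 - ε * -(1 / (16 * Real.pi) * driftStrength k₀ N 1 * responseIntegral k)|
        ≤ C * ε ^ 2 := by
  have hρ := meanDensity_pos hN
  set D : ℝ := driftStrength k₀ N 1 * (B * (2 * Real.pi)) with hD
  have hd1 : 0 < driftStrength k₀ N 1 := by unfold driftStrength; positivity
  have hdε : ∀ ε, driftStrength k₀ N ε = ε * driftStrength k₀ N 1 := fun ε => by
    unfold driftStrength; ring
  have hD0 : 0 ≤ D := by
    have := hk.nonneg
    have := Real.pi_pos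
    positivity
  refine ⟨30 * D ^ 2, 1 / (2 * (D + 1)), by positivity, fun ε hε μ hμ => ?_⟩
  have hε2 : ε * D ≤ 1 / 2 := by
    have h1 := hε.2.le
    rw [le_div_iff₀ (by positivity)] at h1
    nlinarith [hε.1]
  have := IsPrincipal.abs_sub_le (f := fun x => driftStrength k₀ N ε * profilePrimitive k x)
    (δ := ε * D) (continuousOn_const.mul hk.continuousOn) (mul_nonneg hε.1 hD0) hε2
    (fun x hx => by
      rw [hdε, mul_assoc, abs_mul, abs_mul, abs_of_nonneg hε.1, abs_of_pos hd1, hD]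
      exact mul_le_mul_of_nonneg_left (mul_le_mul_of_nonneg_left (hk.abs_primitive_le hx) hd1.le)
        hε.1) hμ
  simp only [mul_assoc (driftStrength k₀ N ε)] at this
  rw [intervalIntegral.integral_const_mul, hdε] at this
  refine (le_of_eq ?_).trans (this.trans (le_of_eq (by ring)))
  unfold responseIntegral
  congr 1
  ring

/-- At ε = 0 the quadratic estimate forces μ = 1/16, so the hypothesis `hb` is positivity of the
unperturbed discriminant. It persists for small ε by continuity, and the chain rule then
differentiates the damped root. -/
theorem IsBoundedProfile.first_order (hk₀ : 0 < k₀) (hN : 0 < N)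
    (hb : 4 * (k₀ / meanDensity N ^ 2 * (1 / 16)) < b₀ ^ 2) (hk : IsBoundedProfile k B) :
    (∃ ε₀ : ℝ, 0 < ε₀ ∧ ∀ ε ∈ Ico 0 ε₀,
      IsLeastStable (eigenvaluesND k₀ b₀ ε N k (fun x => -k x)) (sOnePlus k₀ b₀ N k ε)) ∧
    sOnePlus k₀ b₀ N k 0 = dampedRoot b₀ (k₀ / meanDensity N ^ 2 * (1 / 16)) ∧
    HasDerivWithinAt (sOnePlus k₀ b₀ N k) (responseFactor k₀ b₀ N * responseIntegral k)
      (Ici 0) 0 := by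
  obtain ⟨C, τ, hτ, hquad⟩ := hk.quadratic_principal (k₀ := k₀) hk₀ hN
  choose μ hμ using fun ε => hk.exists_isPrincipal (k₀ := k₀) (N := N) (ε := ε)
  set a := k₀ / meanDensity N ^ 2 with ha
  set d := -(1 / (16 * Real.pi) * driftStrength k₀ N 1 * responseIntegral k) with hd
  have hμ0 : μ 0 = 1 / 16 := by
    have := hquad 0 ⟨le_rfl, hτ⟩ (μ 0) (hμ 0)
    simp only [zero_mul, sub_zero, ne_eq, OfNat.ofNat_ne_zero, not_false_eq_true, zero_pow,
      mul_zero, abs_nonpos_iff] at this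
    linarith
  have hμd : HasDerivWithinAt μ d (Ici 0) 0 :=
    hasDerivWithinAt_of_quadratic hτ fun ε hε => by rw [hμ0]; exact hquad ε hε _ (hμ ε)
  have hev : ∀ᶠ ε in 𝓝[Ici 0] (0 : ℝ), 4 * (a * μ ε) < b₀ ^ 2 := by
    have hc : Tendsto (fun ε => 4 * (a * μ ε)) (𝓝[Ici 0] 0) (𝓝 (4 * (a * μ 0))) :=
      (hμd.continuousWithinAt.tendsto.const_mul a).const_mul 4
    exact hc.eventually (gt_mem_nhds (by rw [hμ0]; exact hb))
  have hs : ∀ ε, 4 * (a * μ ε) < b₀ ^ 2 → sOnePlus k₀ b₀ N k ε = dampedRoot b₀ (a * μ ε) :=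
    fun ε h => sOnePlus_eq hk₀ hN hk (hμ ε) h
  have hs0 : sOnePlus k₀ b₀ N k 0 = dampedRoot b₀ (a * μ 0) := hs 0 (by rw [hμ0]; exact hb)
  refine ⟨?_, by rw [hs0, hμ0], ?_⟩
  · obtain ⟨ε₀, hε₀, hsub⟩ := (mem_nhdsGE_iff_exists_Ico_subset).1 hev
    refine ⟨ε₀, hε₀, fun ε hε => ?_⟩
    have h : 4 * (a * μ ε) < b₀ ^ 2 := hsub hε
    rw [hs ε h]
    exact isLeastStable_of_isPrincipal hk₀ hN hk (hμ ε) h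
  · have hroot : HasDerivAt (dampedRoot b₀) (-1 / Real.sqrt (b₀ ^ 2 - 4 * (a * (1 / 16))))
        (a * μ 0) := by rw [hμ0]; exact hasDerivAt_dampedRoot hb
    refine ((hroot.comp_hasDerivWithinAt 0 (hμd.const_mul a)).congr_of_eventuallyEq
      (hev.mono fun ε h => hs ε h) hs0).congr_deriv ?_
    rw [hd, responseFactor, ← ha]
    ring

/-- Integration by parts against 2 sin(x/2). The boundary terms vanish because the primitive is 0 at
0 and the sine is 0 at 2π. -/
theorem IsBoundedProfile.responseIntegral_eq (hk : IsBoundedProfile k B) :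
    responseIntegral k = -2 * ∫ x in (0 : ℝ)..(2 * Real.pi), k x * Real.sin (x / 2) := by
  have hdom : uIcc 0 (2 * Real.pi) = dom := uIcc_of_le Real.two_pi_pos.le
  have hK : AbsolutelyContinuousOnInterval (profilePrimitive k) 0 (2 * Real.pi) :=
    hk.intervalIntegrable.absolutelyContinuousOnInterval_intervalIntegral left_mem_uIcc
  have hd : ∀ x : ℝ, HasDerivAt (fun x => 2 * Real.sin (x / 2)) (Real.cos (x / 2)) x := fun x =>
    (((hasDerivAt_id x).div_const 2).sin.const_mul 2).congr_deriv (by simp only [id]; ring)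
  have hS : AbsolutelyContinuousOnInterval (fun x => 2 * Real.sin (x / 2)) 0 (2 * Real.pi) := by
    refine ContDiffOn.absolutelyContinuousOnInterval (ContDiff.contDiffOn ?_)
    fun_prop
  have h := hK.integral_mul_deriv_eq_deriv_mul hS
  have hder : deriv (fun x => 2 * Real.sin (x / 2)) = fun x => Real.cos (x / 2) :=
    funext fun x => (hd x).deriv
  rw [hder] at h
  unfold responseIntegral
  rw [h]
  have h2 : ∫ x in (0 : ℝ)..(2 * Real.pi), deriv (profilePrimitive k) x * (2 * Real.sin (x / 2)) =
      ∫ x in (0 : ℝ)..(2 * Real.pi), 2 * (k x * Real.sin (x / 2)) := by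
    refine intervalIntegral.integral_congr_ae ?_
    filter_upwards [hk.intervalIntegrable.ae_hasDerivAt_integral] with x hx hmem
    have : HasDerivAt (profilePrimitive k) (k x) x := hx (uIoc_subset_uIcc hmem) 0 left_mem_uIcc
    rw [this.deriv]
    ring
  rw [h2, intervalIntegral.integral_const_mul]
  simp [profilePrimitive]

end FirstOrder

/-! ### Admissible profiles and optimality of the constant one -/

theorem domainMeasure_ne_zero : domainMeasure ≠ 0 := by
  unfold domainMeasure
  rw [Ne, Measure.restrict_eq_zero, Real.volume_Icc, ENNReal.ofReal_eq_zero, not_le, sub_zero]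
  exact Real.two_pi_pos

instance : IsFiniteMeasure domainMeasure := by
  unfold domainMeasure; infer_instance

theorem isAdmissible_one : IsAdmissible (fun _ => 1) :=
  ⟨memLp_const 1, essSup_const 1 domainMeasure_ne_zero⟩

theorem isBoundedProfile_one : IsBoundedProfile (fun _ => 1) 1 :=
  ⟨aestronglyMeasurable_const, zero_le_one, by simp⟩

theorem IsAdmissible.exists_isBoundedProfile {k : ℝ → ℝ} (hk : IsAdmissible k) :
    ∃ B, IsBoundedProfile k B :=
  ⟨_, hk.1.aestronglyMeasurable, lpNorm_nonneg, ae_le_lpNorm_exponent_top hk.1⟩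

theorem IsAdmissible.le_one {k : ℝ → ℝ} (hk : IsAdmissible k) :
    ∀ᵐ x ∂domainMeasure, k x ≤ 1 := by
  obtain ⟨B, hB⟩ := hk.exists_isBoundedProfile
  have hbdd : IsBoundedUnder (· ≤ ·) (ae domainMeasure) k :=
    ⟨B, eventually_map.2 (hB.bound.mono fun x hx => (le_abs_self _).trans hx)⟩
  have := ae_le_essSup hbdd
  rwa [hk.2] at this

/-- The difference of the responses is 2∫(1 - k) sin(x/2), whose integrand is nonnegative. Equality
makes it vanish almost everywhere, and the sine is positive away from the two endpoints. -/
theorem IsAdmissible.responseIntegral_le {k : ℝ → ℝ} (hk : IsAdmissible k) :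
    responseIntegral (fun _ => 1) ≤ responseIntegral k ∧
      (responseIntegral k = responseIntegral (fun _ => 1) ↔
        k =ᵐ[domainMeasure] fun _ => 1) := by
  obtain ⟨B, hB⟩ := hk.exists_isBoundedProfile
  have hsc : ContinuousOn (fun x : ℝ => Real.sin (x / 2)) (uIcc 0 (2 * Real.pi)) := by fun_prop
  have hdiff : responseIntegral k - responseIntegral (fun _ => 1) =
      2 * ∫ x, (1 - k x) * Real.sin (x / 2) ∂domainMeasure := by
    rw [hB.responseIntegral_eq, isBoundedProfile_one.responseIntegral_eq, domainMeasure,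
      integral_Icc_eq_integral_Ioc, ← intervalIntegral.integral_of_le Real.two_pi_pos.le]
    simp only [sub_mul]
    rw [intervalIntegral.integral_sub
      (isBoundedProfile_one.intervalIntegrable.mul_continuousOn hsc)
      (hB.intervalIntegrable.mul_continuousOn hsc)]
    ring
  have hnn : 0 ≤ᵐ[domainMeasure] fun x => (1 - k x) * Real.sin (x / 2) := by
    filter_upwards [hk.le_one, ae_restrict_mem measurableSet_Icc] with x hx hmem
    refine mul_nonneg (sub_nonneg.2 hx) (Real.sin_nonneg_of_nonneg_of_le_pi ?_ ?_)
    · linarith [hmem.1]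
    · linarith [hmem.2]
  have hint : Integrable (fun x => (1 - k x) * Real.sin (x / 2)) domainMeasure := by
    have := ((isBoundedProfile_one.intervalIntegrable.sub
      hB.intervalIntegrable).mul_continuousOn hsc)
    rwa [intervalIntegrable_iff_integrableOn_Icc_of_le Real.two_pi_pos.le] at this
  refine ⟨by linarith [integral_nonneg_of_ae hnn], ?_⟩
  rw [← sub_eq_zero, hdiff, mul_eq_zero_iff_left two_ne_zero,
    integral_eq_zero_iff_of_nonneg_ae hnn hint]
  constructor
  · intro h
    have hends : ∀ᵐ x ∂domainMeasure, x ≠ 0 ∧ x ≠ 2 * Real.pi :=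
      ae_restrict_of_ae ((Measure.ae_ne volume 0).and (Measure.ae_ne volume (2 * Real.pi)))
    filter_upwards [h, hends, ae_restrict_mem measurableSet_Icc] with x hx hne hmem
    have hs : 0 < Real.sin (x / 2) := Real.sin_pos_of_pos_of_lt_pi
      (by linarith [lt_of_le_of_ne hmem.1 hne.1.symm])
      (by linarith [lt_of_le_of_ne hmem.2 hne.2])
    have := (mul_eq_zero.1 hx).resolve_right hs.ne'
    linarith
  · intro h
    filter_upwards [h] with x hx
    simp [hx]

theorem eventually_lt_of_deriv_lt {f g : ℝ → ℝ} {f' g' : ℝ}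
    (hf : HasDerivWithinAt f f' (Ici 0) 0) (hg : HasDerivWithinAt g g' (Ici 0) 0)
    (h0 : f 0 = g 0) (hlt : f' < g') : ∀ᶠ ε in 𝓝[>] (0 : ℝ), f ε < g ε := by
  have h := hasDerivWithinAt_iff_tendsto_slope.1 (hg.sub hf)
  rw [Ici_sdiff_left] at h
  filter_upwards [h.eventually (lt_mem_nhds (sub_pos.2 hlt)), self_mem_nhdsWithin] with ε hε hpos
  rw [slope_def_field, Pi.sub_apply, Pi.sub_apply, h0, sub_self, sub_zero, sub_zero] at hε
  have := (div_pos_iff_of_pos_right (show (0 : ℝ) < ε from hpos)).1 hε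
  linarith

theorem profilePrimitive_one (x : ℝ) : profilePrimitive (fun _ => 1) x = x := by
  simp [profilePrimitive]

theorem responseIntegral_one : responseIntegral (fun _ => 1) = -8 := by
  unfold responseIntegral
  simp only [profilePrimitive_one]
  exact integral_id_mul_cos_half

/-! ### Uniform asymptotics for the constant profile -/

section Uniform

variable {k₀ b₀ : ℝ}

theorem sqrt_gap_bounds {a : ℝ} (hb₀ : 0 < b₀) (ha0 : 0 < a) (hab : a ≤ b₀ ^ 2) :
    b₀ / 2 ≤ Real.sqrt (b₀ ^ 2 - 4 * (a * (1 / 16))) ∧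
      0 ≤ b₀ - Real.sqrt (b₀ ^ 2 - 4 * (a * (1 / 16))) ∧
      (b₀ - Real.sqrt (b₀ ^ 2 - 4 * (a * (1 / 16)))) * b₀ ≤ a / 4 := by
  have h1 : b₀ / 2 ≤ Real.sqrt (b₀ ^ 2 - 4 * (a * (1 / 16))) :=
    Real.le_sqrt_of_sq_le (by linarith)
  have h2 : Real.sqrt (b₀ ^ 2 - 4 * (a * (1 / 16))) ^ 2 = b₀ ^ 2 - 4 * (a * (1 / 16)) :=
    Real.sq_sqrt (by linarith)
  have h3 : Real.sqrt (b₀ ^ 2 - 4 * (a * (1 / 16))) ≤ b₀ :=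
    (Real.sqrt_le_left hb₀.le).2 (by linarith)
  exact ⟨h1, by linarith, by nlinarith⟩

/-- Size of the unperturbed eigenvalue and of the derivative for the constant profile. -/
theorem constant_profile_rates {a D n : ℝ} (hb₀ : 0 < b₀) (hn : 1 ≤ n)
    (ha : a = 4 * Real.pi ^ 2 * k₀ / n ^ 2) (ha0 : 0 < a) (hD : b₀ / 2 ≤ D) (hDb : 0 ≤ b₀ - D)
    (hgap : (b₀ - D) * b₀ ≤ a / 4) :
    |(-b₀ + D) / 2| ≤ Real.pi ^ 2 * k₀ / (2 * b₀) / n ^ 2 ∧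
      |-(2 / (n * D)) - -2 / (b₀ * n)| ≤ 4 * Real.pi ^ 2 * k₀ / b₀ ^ 3 / n ^ 2 := by
  have hnpos : 0 < n := by linarith
  have hDpos : 0 < D := by linarith
  constructor
  · rw [show (-b₀ + D) / 2 = -((b₀ - D) / 2) by ring, abs_neg, abs_of_nonneg (by linarith)]
    have h2 : Real.pi ^ 2 * k₀ / (2 * b₀) / n ^ 2 = a / 4 / (2 * b₀) := by
      rw [ha]; field_simp
    rw [h2, div_le_div_iff₀ two_pos (by positivity)]
    linarith
  · have h1 : -(2 / (n * D)) - -2 / (b₀ * n) = -(2 * (b₀ - D) / (n * (D * b₀))) := by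
      field_simp; ring
    rw [h1, abs_neg, abs_of_nonneg (div_nonneg (by linarith) (by positivity))]
    have h2 : 4 * Real.pi ^ 2 * k₀ / b₀ ^ 3 / n ^ 2 = a / b₀ ^ 3 := by rw [ha]; field_simp
    rw [h2, div_le_div_iff₀ (by positivity) (by positivity)]
    have h3 : b₀ ^ 2 ≤ 2 * (D * b₀) := by nlinarith
    calc 2 * (b₀ - D) * b₀ ^ 3 = 2 * ((b₀ - D) * b₀) * b₀ ^ 2 := by ring
      _ ≤ 2 * (a / 4) * (2 * (D * b₀)) :=
          mul_le_mul (by linarith) h3 (by positivity) (by positivity)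
      _ = a * (1 * (D * b₀)) := by ring
      _ ≤ a * (n * (D * b₀)) := by gcongr

/-- Uniform control of the scaled principal eigenvalue for the constant profile. -/
theorem abs_scaled_principal_sub_le (hk₀ : 0 < k₀) {N : ℕ} (hN : 0 < N) {ε μ : ℝ} (hε : 0 ≤ ε)
    (hμ : IsPrincipal (sturmWeight k₀ N (fun _ => 1) ε) μ) :
    |k₀ / meanDensity N ^ 2 * μ - k₀ / meanDensity N ^ 2 * (1 / 16) - 2 * ε / N|
      ≤ 4 * (120 * Real.pi ^ 2 + 3) / k₀ * ε ^ 2 := by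
  have hρ := meanDensity_pos hN
  have hNpos : (0 : ℝ) < N := by exact_mod_cast hN
  have hπ := Real.pi_pos
  have hμb : |μ - 1 / 16 - driftStrength k₀ N ε / (2 * Real.pi)|
      ≤ (120 * Real.pi ^ 2 + 3) * driftStrength k₀ N ε ^ 2 := by
    refine IsPrincipal.abs_sub_le_of_exp_mul (by unfold driftStrength; positivity) ?_
    have : sturmWeight k₀ N (fun _ => 1) ε = fun x => Real.exp (driftStrength k₀ N ε * x) := by
      funext x; rw [sturmWeight, profilePrimitive_one]
    rwa [this] at hμ
  have h1 : k₀ / meanDensity N ^ 2 * μ - k₀ / meanDensity N ^ 2 * (1 / 16) - 2 * ε / N =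
      k₀ / meanDensity N ^ 2 * (μ - 1 / 16 - driftStrength k₀ N ε / (2 * Real.pi)) := by
    rw [driftStrength, meanDensity]; field_simp
  rw [h1, abs_mul, abs_of_pos (by positivity)]
  refine (mul_le_mul_of_nonneg_left hμb (by positivity)).trans (le_of_eq ?_)
  -- The drift strength grows like εN while a₀² decays like N⁻², so the powers of N cancel in the
  -- error term a₀²c² = 4ε²/k₀.
  rw [driftStrength, meanDensity]; field_simp; ring

/-- First-order expansion of the damped root with a quadratically small perturbation. -/
theorem abs_dampedRoot_expansion_le {m₀ m D E n ε : ℝ} (hb₀ : 0 < b₀)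
    (hm₀ : 4 * m₀ ≤ 3 / 4 * b₀ ^ 2) (hm : 4 * m ≤ 3 / 4 * b₀ ^ 2)
    (hD : D = Real.sqrt (b₀ ^ 2 - 4 * m₀)) (hDlow : b₀ / 2 ≤ D) (hn : 1 ≤ n) (hε : 0 ≤ ε)
    (hε1 : ε ≤ 1) (hE : 0 ≤ E) (he : |m - m₀ - 2 * ε / n| ≤ E * ε ^ 2) :
    |dampedRoot b₀ m - (dampedRoot b₀ m₀ + ε * -(2 / (n * D)))|
      ≤ (8 / b₀ ^ 3 * (2 + E) ^ 2 + 2 * E / b₀) * ε ^ 2 := by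
  have hDpos : 0 < D := by linarith
  have hnpos : 0 < n := by linarith
  have h1 := abs_dampedRoot_sub_le hb₀ hm₀ hm
  rw [← hD] at h1
  have hεn : 2 * ε / n ≤ 2 * ε := div_le_self (by linarith) hn
  have hεn0 : 0 ≤ 2 * ε / n := div_nonneg (by linarith) hnpos.le
  have hEε : E * ε ^ 2 ≤ E * ε := mul_le_mul_of_nonneg_left (by nlinarith) hE
  have h2 : |m - m₀| ≤ (2 + E) * ε := by
    rw [abs_le] at he ⊢
    constructor <;> linarith [he.1, he.2]
  have h3 : (m - m₀) ^ 2 ≤ ((2 + E) * ε) ^ 2 := by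
    rw [← sq_abs]
    exact pow_le_pow_left₀ (abs_nonneg _) h2 2
  have h4 : dampedRoot b₀ m - (dampedRoot b₀ m₀ + ε * -(2 / (n * D))) =
      (dampedRoot b₀ m - dampedRoot b₀ m₀ + (m - m₀) / D) - (m - m₀ - 2 * ε / n) / D := by
    field_simp; ring
  have h5 : |(m - m₀ - 2 * ε / n) / D| ≤ 2 * E / b₀ * ε ^ 2 := by
    rw [abs_div, abs_of_pos hDpos, div_le_iff₀ hDpos]
    refine he.trans ?_
    have : 1 ≤ 2 / b₀ * D := by rw [div_mul_eq_mul_div, le_div_iff₀ hb₀]; linarith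
    calc E * ε ^ 2 = E * ε ^ 2 * 1 := by ring
      _ ≤ E * ε ^ 2 * (2 / b₀ * D) := by gcongr
      _ = 2 * E / b₀ * ε ^ 2 * D := by ring
  rw [h4]
  refine (abs_sub _ _).trans ?_
  have h6 := mul_le_mul_of_nonneg_left h3 (by positivity : 0 ≤ 8 / b₀ ^ 3)
  calc _ ≤ 8 / b₀ ^ 3 * ((2 + E) * ε) ^ 2 + 2 * E / b₀ * ε ^ 2 := add_le_add (h1.trans h6) h5
    _ = _ := by ring

/-- Uniform asymptotics of `s₁⁺` for the constant profile. -/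
theorem uniform_asymptotics (hk₀ : 0 < k₀) (hb₀ : 0 < b₀) :
    ∃ (C ε₀ : ℝ) (N₀ : ℕ), 0 < ε₀ ∧ 0 < N₀ ∧ ∀ N : ℕ, N₀ ≤ N →
      ∃ r : ℝ,
        HasDerivWithinAt (sOnePlus k₀ b₀ N (fun _ => 1)) r (Ici 0) 0 ∧
        |sOnePlus k₀ b₀ N (fun _ => 1) 0| ≤ C / (N : ℝ) ^ 2 ∧
        |r - -2 / (b₀ * N)| ≤ C / (N : ℝ) ^ 2 ∧
        ∀ ε ∈ Icc 0 ε₀,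
          IsLeastStable (eigenvaluesND k₀ b₀ ε N (fun _ => 1) (fun _ => -1))
            (sOnePlus k₀ b₀ N (fun _ => 1) ε) ∧
          |sOnePlus k₀ b₀ N (fun _ => 1) ε - (sOnePlus k₀ b₀ N (fun _ => 1) 0 + ε * r)|
            ≤ C * ε ^ 2 ∧
          |sOnePlus k₀ b₀ N (fun _ => 1) ε - -(2 * ε) / (b₀ * N)| ≤
            C * (ε ^ 2 + 1 / (N : ℝ) ^ 2) := by
  have hπ := Real.pi_pos
  set C₁ : ℝ := 120 * Real.pi ^ 2 + 3 with hC₁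
  have hC₁0 : 0 < C₁ := by positivity
  set E : ℝ := 4 * C₁ / k₀ with hE
  have hE0 : 0 < E := by positivity
  set C₂ : ℝ := 8 / b₀ ^ 3 * (2 + E) ^ 2 + 2 * E / b₀ with hC₂
  set C₃ : ℝ := 4 * Real.pi ^ 2 * k₀ / b₀ ^ 3 with hC₃
  set C₄ : ℝ := Real.pi ^ 2 * k₀ / (2 * b₀) with hC₄
  have hC₂0 : 0 < C₂ := by positivity
  have hC₃0 : 0 < C₃ := by positivity
  have hC₄0 : 0 < C₄ := by positivity
  -- In 4a₀²μ ≤ a₀²/4 + 8ε + 4Eε², each of the three terms is to be at most b₀²/4. The last two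
  -- entries of the minimum handle the ε terms, and the choice of `N₁` ensures a₀² ≤ b₀².
  set ε₀ : ℝ := min 1 (min (b₀ ^ 2 / 32) (b₀ ^ 2 / (16 * E))) with hε₀
  have hε₀1 : ε₀ ≤ 1 := min_le_left _ _
  have hε₀2 : ε₀ ≤ b₀ ^ 2 / 32 := (min_le_right _ _).trans (min_le_left _ _)
  have hε₀3 : ε₀ * (16 * E) ≤ b₀ ^ 2 := by
    rw [← le_div_iff₀ (by positivity)]
    exact (min_le_right _ _).trans (min_le_right _ _)
  obtain ⟨N₁, hN₁⟩ := exists_nat_ge (4 * Real.pi ^ 2 * k₀ / b₀ ^ 2)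
  refine ⟨C₂ + C₃ + C₄, ε₀, N₁ + 1, by positivity, by omega, fun N hN => ?_⟩
  have hN0 : 0 < N := by omega
  have hN1 : (1 : ℝ) ≤ N := by exact_mod_cast hN0
  have hNpos : (0 : ℝ) < N := by linarith
  have hNbig : 4 * Real.pi ^ 2 * k₀ ≤ b₀ ^ 2 * N := by
    have h1 : (N₁ : ℝ) ≤ N := by exact_mod_cast (by omega : N₁ ≤ N)
    have h2 := hN₁.trans h1
    rw [div_le_iff₀ (by positivity)] at h2
    linarith
  set a : ℝ := k₀ / meanDensity N ^ 2 with ha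
  have haN : a = 4 * Real.pi ^ 2 * k₀ / N ^ 2 := by
    rw [ha, meanDensity]; field_simp; ring
  have ha0 : 0 < a := by rw [haN]; positivity
  have hab : a ≤ b₀ ^ 2 := by
    rw [haN, div_le_iff₀ (by positivity)]
    nlinarith [mul_le_mul_of_nonneg_left hN1 (by positivity : 0 ≤ b₀ ^ 2 * N)]
  have hb' : 4 * (a * (1 / 16)) ≤ 3 / 4 * b₀ ^ 2 := by linarith
  have hb : 4 * (a * (1 / 16)) < b₀ ^ 2 := hb'.trans_lt (by linarith [pow_pos hb₀ 2])
  obtain ⟨-, hs0, hr⟩ := isBoundedProfile_one.first_order hk₀ hN0 hb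
  rw [← ha] at hs0
  set S := sOnePlus k₀ b₀ N (fun _ => 1) with hS
  set D : ℝ := Real.sqrt (b₀ ^ 2 - 4 * (a * (1 / 16))) with hD
  obtain ⟨hDlow, hDb, hgap⟩ := sqrt_gap_bounds hb₀ ha0 hab
  rw [← hD] at hDlow hDb hgap
  have hrval : responseFactor k₀ b₀ N * responseIntegral (fun _ => 1) = -(2 / (N * D)) := by
    rw [responseIntegral_one, responseFactor, ← ha, ← hD, haN, driftStrength, meanDensity]
    field_simp
    ring
  rw [hrval] at hr
  obtain ⟨hs0le, hrle⟩ := constant_profile_rates hb₀ hN1 haN ha0 hDlow hDb hgap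
  replace hs0le : |S 0| ≤ C₄ / (N : ℝ) ^ 2 := by rwa [hs0, dampedRoot, ← hD]
  have hN2 : (0 : ℝ) < (N : ℝ) ^ 2 := by positivity
  refine ⟨_, hr, hs0le.trans (by gcongr; linarith), hrle.trans (by gcongr; linarith),
    fun ε hε => ?_⟩
  obtain ⟨μ, hμ⟩ := isBoundedProfile_one.exists_isPrincipal (k₀ := k₀) (N := N) (ε := ε)
  have hε1 : ε ≤ 1 := hε.2.trans hε₀1
  have heb := abs_scaled_principal_sub_le hk₀ hN0 hε.1 hμ
  rw [← ha, ← hC₁, ← hE] at heb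
  have hεN : 2 * ε / N ≤ 2 * ε := div_le_self (by linarith [hε.1]) hN1
  have hεN0 : 0 ≤ 2 * ε / N := div_nonneg (by linarith [hε.1]) hNpos.le
  have hEε : E * ε ^ 2 ≤ E * ε₀ :=
    mul_le_mul_of_nonneg_left (by nlinarith [hε.1, hε.2]) hE0.le
  have hm : 4 * (a * μ) ≤ 3 / 4 * b₀ ^ 2 := by
    have h1 := (abs_le.1 heb).2
    have h3 := hε.2
    linarith
  have hm' : 4 * (a * μ) < b₀ ^ 2 := hm.trans_lt (by linarith [pow_pos hb₀ 2])
  have hls := isLeastStable_of_isPrincipal hk₀ hN0 isBoundedProfile_one hμ hm'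
  have hSε : S ε = dampedRoot b₀ (a * μ) := hls.sSup_eq
  have hmain : |S ε - (S 0 + ε * -(2 / (N * D)))| ≤ C₂ * ε ^ 2 := by
    rw [hSε, hs0]
    exact abs_dampedRoot_expansion_le hb₀ hb' hm hD hDlow hN1 hε.1 hε1 hE0.le heb
  refine ⟨?_, hmain.trans ?_, ?_⟩
  · rw [hSε]; exact hls
  · have := sq_nonneg ε
    gcongr
    linarith
  · have h1 : S ε - -(2 * ε) / (b₀ * N) = (S ε - (S 0 + ε * -(2 / (N * D)))) +
        (S 0 + ε * (-(2 / (N * D)) - -2 / (b₀ * N))) := by ring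
    rw [h1]
    have h2 : |ε * (-(2 / (N * D)) - -2 / (b₀ * N))| ≤ C₃ / (N : ℝ) ^ 2 := by
      rw [abs_mul, abs_of_nonneg hε.1]
      calc ε * |-(2 / (N * D)) - -2 / (b₀ * N)| ≤ 1 * |-(2 / (N * D)) - -2 / (b₀ * N)| := by
            gcongr
        _ ≤ C₃ / (N : ℝ) ^ 2 := by rw [one_mul]; exact hrle
    refine (abs_add_le _ _).trans ((add_le_add hmain
      ((abs_add_le _ _).trans (add_le_add hs0le h2))).trans ?_)
    have h3 : 0 ≤ 1 / (N : ℝ) ^ 2 := by positivity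
    have h4 : C₄ / (N : ℝ) ^ 2 + C₃ / (N : ℝ) ^ 2 = (C₄ + C₃) * (1 / (N : ℝ) ^ 2) := by ring
    rw [h4]
    linarith [mul_nonneg hC₂0.le h3,
      mul_nonneg (add_nonneg hC₃0.le hC₄0.le) (sq_nonneg ε)]

end Uniform

end Platoon

/-! ### Main theorem -/

theorem mainTheorem2 (k₀ b₀ : ℝ) (hk₀ : 0 < k₀) (hb₀ : 0 < b₀) :
    -- the constant profile `1` is admissible
    Platoon.IsAdmissible (fun _ => 1) ∧
    -- the constant profile `1` is the first-order optimal profile, and it is unique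
    (∀ N : ℕ, Real.pi * Real.sqrt k₀ / b₀ < N →
      ∃ r : ℝ,
        HasDerivWithinAt (Platoon.sOnePlus k₀ b₀ N (fun _ => 1)) r (Ici 0) 0 ∧
        ∀ k : ℝ → ℝ, Platoon.IsAdmissible k →
          (∃ ε₀ : ℝ, 0 < ε₀ ∧ ∀ ε ∈ Ico 0 ε₀,
            Platoon.IsLeastStable (Platoon.eigenvaluesND k₀ b₀ ε N k (fun x => -k x))
              (Platoon.sOnePlus k₀ b₀ N k ε)) ∧
          (∃ r' : ℝ, HasDerivWithinAt (Platoon.sOnePlus k₀ b₀ N k) r' (Ici 0) 0 ∧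
            r ≤ r' ∧ (r' = r ↔ k =ᵐ[Platoon.domainMeasure] fun _ => 1)) ∧
          (¬ (k =ᵐ[Platoon.domainMeasure] fun _ => 1) →
            ∀ᶠ ε in 𝓝[>] (0 : ℝ),
              Platoon.sOnePlus k₀ b₀ N (fun _ => 1) ε < Platoon.sOnePlus k₀ b₀ N k ε)) ∧
    -- asymptotics of the least stable eigenvalue for the profile `1`
    (∃ (C ε₀ : ℝ) (N₀ : ℕ), 0 < ε₀ ∧ 0 < N₀ ∧ ∀ N : ℕ, N₀ ≤ N →
      ∃ r : ℝ,
        HasDerivWithinAt (Platoon.sOnePlus k₀ b₀ N (fun _ => 1)) r (Ici 0) 0 ∧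
        |Platoon.sOnePlus k₀ b₀ N (fun _ => 1) 0| ≤ C / (N : ℝ) ^ 2 ∧
        |r - -2 / (b₀ * N)| ≤ C / (N : ℝ) ^ 2 ∧
        ∀ ε ∈ Icc 0 ε₀,
          Platoon.IsLeastStable
            (Platoon.eigenvaluesND k₀ b₀ ε N (fun _ => 1) (fun _ => -1))
            (Platoon.sOnePlus k₀ b₀ N (fun _ => 1) ε) ∧
          |Platoon.sOnePlus k₀ b₀ N (fun _ => 1) ε -
            (Platoon.sOnePlus k₀ b₀ N (fun _ => 1) 0 + ε * r)| ≤ C * ε ^ 2 ∧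
          |Platoon.sOnePlus k₀ b₀ N (fun _ => 1) ε - -(2 * ε) / (b₀ * N)| ≤
            C * (ε ^ 2 + 1 / (N : ℝ) ^ 2)) := by
  refine ⟨Platoon.isAdmissible_one, fun N hN => ?_, Platoon.uniform_asymptotics hk₀ hb₀⟩
  have hNpos : (0 : ℝ) < N := lt_of_le_of_lt (by positivity) hN
  have hN0 : 0 < N := by exact_mod_cast hNpos
  -- With a₀² = 4π²k₀/N² and unperturbed eigenvalue 1/16, the lower bound on `N` is exactly
  -- positivity of the discriminant at ε = 0.
  have hb : 4 * (k₀ / Platoon.meanDensity N ^ 2 * (1 / 16)) < b₀ ^ 2 := by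
    rw [div_lt_iff₀ hb₀] at hN
    have hsq := pow_lt_pow_left₀ hN (by positivity) two_ne_zero
    rw [mul_pow, mul_pow, Real.sq_sqrt hk₀.le] at hsq
    have : 4 * (k₀ / Platoon.meanDensity N ^ 2 * (1 / 16)) = Real.pi ^ 2 * k₀ / N ^ 2 := by
      have := Real.pi_pos
      rw [Platoon.meanDensity]; field_simp; ring
    rw [this, div_lt_iff₀ (by positivity)]
    linarith
  obtain ⟨-, h10, h1⟩ := Platoon.isBoundedProfile_one.first_order hk₀ hN0 hb
  have hP := Platoon.responseFactor_pos hk₀ hN0 hb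
  refine ⟨_, h1, fun k hk => ?_⟩
  obtain ⟨B, hB⟩ := hk.exists_isBoundedProfile
  obtain ⟨hls, hk0, hkd⟩ := hB.first_order hk₀ hN0 hb
  obtain ⟨hle, heq⟩ := hk.responseIntegral_le
  refine ⟨hls, ⟨_, hkd, mul_le_mul_of_nonneg_left hle hP.le, ?_⟩, fun hne => ?_⟩
  · rw [← heq]
    exact mul_right_inj' hP.ne'
  · refine Platoon.eventually_lt_of_deriv_lt h1 hkd (h10.trans hk0.symm)
      (mul_lt_mul_of_pos_left (lt_of_le_of_ne hle fun h => hne (heq.1 h.symm)) hP)
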